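/- Let $A$ be a commutative ring, let $p,d\in A$ with $d$ a non-zero-divisor, and put $I=(p,d)$. Call an $A$-module $N$ *$I$-torsion* if every element of $N$ is annihilated by some power of $I$. A (possibly unbounded) complex $M$ of $A$-modules is called *$I$-completely flat* if for every $I$-torsion $A$-module $N$ the derived tensor product $M\otimes^{L}_A N$ is concentrated in degree $0$, i.e. $H^n(M\otimes^L_A N)=0$ for all $n\neq 0$. A complex $K$ is *derived $I$-complete* if for every $f\in I$ the derived limit $T(K,f)=R\lim(\cdots\xrightarrow{f}K\xrightarrow{f}K\xrightarrow{f}K)$ vanishes in $D(A)$. A *derived $I$-completion* of $M$ is a morphism $M\to M^\wedge$ in $D(A)$ with $M^\wedge$ derived $I$-complete such that $\operatorname{Hom}_{D(A)}(M^\wedge,E)\to\operatorname{Hom}_{D(A)}(M,E)$ is bijective for every derived $I$-complete $E$. If $M$ is an $I$-completely flat complex of $A$-modules, then its derived $I$-completion $M^\wedge$ (which exists, and is unique up to unique isomorphism in $D(A)$) is $I$-completely flat; that is, a derived $I$-completion of $M$ exists, and every derived $I$-completion of $M$ is $I$-completely flat. -/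

import Mathlib

open CategoryTheory CategoryTheory.Limits

universe w u

noncomputable section

namespace CompletelyFlat

variable {A : Type u} [CommRing A]

/-- Complexes of `A`-modules: unbounded, cohomologically indexed by `ℤ`. -/
abbrev Cplx (A : Type u) [CommRing A] : Type (u + 1) := CochainComplex (ModuleCat.{u} A) ℤ

/-- An `A`-module is `I`-torsion if each of its elements is annihilated by some power of `I`. -/
def IsITorsion (I : Ideal A) (N : ModuleCat.{u} A) : Prop :=
  ∀ x : N, ∃ k : ℕ, ∀ a ∈ I ^ k, a • x = 0

/-- The derived tensor product `M ⊗ᴸ N` of a complex `M` and a module `N`: the total (direct sum)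
tensor product of `M` with a projective resolution of `N`, placed in degrees `≤ 0`. -/
def derivedTensor (M : Cplx A) (N : ModuleCat.{u} A) : Cplx A :=
  HomologicalComplex.tensorObj M (projectiveResolution N).cochainComplex

/-- `M` is `I`-completely flat if for every `I`-torsion module `N` the cohomology of `M ⊗ᴸ N`
vanishes outside degree `0`. -/
def IsCompletelyFlat (I : Ideal A) (M : Cplx A) : Prop :=
  ∀ N : ModuleCat.{u} A, IsITorsion I N → ∀ n : ℤ, n ≠ 0 → (derivedTensor M N).ExactAt n

/-- The map `(xₙ)ₙ ↦ (xₙ - f • xₙ₊₁)ₙ` from `∏_{n ∈ ℕ} K` to itself, whose homotopy fibre computes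
the derived limit of the tower `⋯ ⟶ K ⟶ K ⟶ K` with all transition maps multiplication by `f`. -/
def towerMap (f : A) (K : Cplx A) : (∏ᶜ fun _ : ℕ => K) ⟶ (∏ᶜ fun _ : ℕ => K) :=
  Pi.lift fun n : ℕ => Pi.π (fun _ : ℕ => K) n - f • Pi.π (fun _ : ℕ => K) (n + 1)

/-- `T(K, f)`, the derived limit of the tower `⋯ ⟶ K ⟶ K ⟶ K` of multiplications by `f`
(equivalently `RHom(A_f, K)`), as the homotopy fibre of `towerMap f K`. Products of modules are
exact, so the termwise product of complexes is the product in the derived category. -/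
def derivedTower (f : A) (K : Cplx A) : Cplx A :=
  (CochainComplex.mappingCone (towerMap f K))⟦(-1 : ℤ)⟧

/-- `K` is derived complete with respect to `I` if `T(K, f)` vanishes in the derived category
for every `f ∈ I`. -/
def IsDerivedComplete (I : Ideal A) (K : Cplx A) : Prop :=
  ∀ f ∈ I, (derivedTower f K).Acyclic

/-- The morphism `η : M ⟶ M'` of the derived category exhibits `M'` as the derived `I`-completion
of `M`: the object `M'` is derived complete, and `η` is universal among the morphisms of the
derived category from `M` to derived complete complexes. In other words, `M'` with `η` is the value
at `M` of the left adjoint of the inclusion of derived complete objects. -/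
structure IsDerivedCompletion [HasDerivedCategory.{w} (ModuleCat.{u} A)] (I : Ideal A)
    {M M' : Cplx A} (η : DerivedCategory.Q.obj M ⟶ DerivedCategory.Q.obj M') : Prop where
  complete : IsDerivedComplete I M'
  universal : ∀ E : Cplx A, IsDerivedComplete I E →
    Function.Bijective fun g : DerivedCategory.Q.obj M' ⟶ DerivedCategory.Q.obj E => η ≫ g

end CompletelyFlat

end

/-!
Write `I = (p, d)`. The completion is built one generator at a time, and the theorem follows from
the fact that completing with respect to `f` changes a complex only by a complex on which `f` is
invertible.

*Completeness is a condition on cohomology.* The complex `∏ K` is modelled by the complex `Seq K`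
of sequences, so `T(K, f)` vanishes if and only if the map `(xₙ) ↦ (xₙ - f xₙ₊₁)` is bijective on
sequences in each `Hⁿ(K)` (`quasiIso_towerMap_iff`, `derivedTower_acyclic_iff`). An endomorphism
with this property is called complete (`IsCompleteEnd`). Complete endomorphisms that commute have a
complete sum, the product of a complete endomorphism with one that commutes with it is complete,
and completeness satisfies the two out of three principle of the five lemma. Therefore derived
`I`-completeness is completeness for `p` and for `d` (`isDerivedComplete_span_pair_iff`).

*The completion.* The completion of `M` with respect to `f` is the cone `completionAt f M` of
`x - f` on power series `M⟦x⟧`. It is `f`-complete because `x` is complete on power series and agrees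
with `f` on the cone up to homotopy, and it inherits completeness for any other element from `M`.
The constant power series give a short exact sequence `M ⟶ completionAt f M ⟶ towerCone f M`
(`completionSequence_shortExact`), where `f` acts bijectively on the cohomology of `towerCone f M`,
the inverse being the left shift of sequences (`hInvertibleFor_towerCone`).

*Universality.* If `f` is bijective on the cohomology of `X` and complete on that of `E`, then
every morphism `X ⟶ E` of the derived category vanishes (`hom_eq_zero`): `X` can be replaced by its
localization, and a map `φ` out of it is the zeroth term of the sequence `φ, φ / f, φ / f², …`,
which is killed by the quasi-isomorphism `(xₙ) ↦ (xₙ - f xₙ₊₁)`. Hence `M ⟶ completionAt f M` is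
universal among maps to `f`-complete objects, and the iterated completion at `p` and `d` is a
derived `I`-completion.

*Flatness.* If `f` is bijective on the cohomology of `X` and `N` is `f`-power torsion, then
`X ⊗ᴸ N` is acyclic (`derivedTensor_acyclic`): after localizing `X`, the projective resolution of `N` can
be localized as well, and over the localized ring it is an acyclic bounded above complex of
projective modules, hence contractible. This uses that tensoring with a bounded above complex of
flat modules preserves acyclicity (`tens_acyclic`). Applied to `towerCone f M` for `f = p` and
`f = d`, it shows that `M ⊗ᴸ N` and the derived tensor product of the completion with `N` are exact in
the same degrees if `N` is `I`-torsion. Every other completion is isomorphic to this one in the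
derived category.
-/

noncomputable section

namespace CompletelyFlat

/-! ### Complete endomorphisms of modules -/

section CompleteEnd

variable {A : Type*} [CommRing A] {H : Type*} [AddCommGroup H] [Module A H]

variable (A H) in
/-- The left shift `(xₙ)ₙ ↦ (xₙ₊₁)ₙ` on sequences. -/
def seqShift : Module.End A (ℕ → H) := LinearMap.funLeft A H Nat.succ

@[simp] lemma seqShift_apply (x : ℕ → H) (n : ℕ) : seqShift A H x n = x (n + 1) := rfl

/-- An endomorphism acting termwise on sequences. -/
def seqEnd (φ : Module.End A H) : Module.End A (ℕ → H) := φ.compLeft ℕ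

@[simp] lemma seqEnd_apply (φ : Module.End A H) (x : ℕ → H) (n : ℕ) :
    seqEnd φ x n = φ (x n) := rfl

/-- The endomorphism `(xₙ)ₙ ↦ (xₙ - φ xₙ₊₁)ₙ` of the module of sequences. -/
def towerEnd (φ : Module.End A H) : Module.End A (ℕ → H) := 1 - seqEnd φ * seqShift A H

@[simp] lemma towerEnd_apply (φ : Module.End A H) (x : ℕ → H) (n : ℕ) :
    towerEnd φ x n = x n - φ (x (n + 1)) := rfl

/-- An endomorphism `φ` is complete if every sequence `(yₙ)ₙ` has a unique sequence of
"sums" `xₙ = yₙ + φ yₙ₊₁ + φ² yₙ₊₂ + ⋯`, that is, of solutions of `xₙ - φ xₙ₊₁ = yₙ`. For `φ` the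
multiplication by `f`, this is the vanishing of `Hom` and `Ext¹` from `A[1/f]`. -/
def IsCompleteEnd (φ : Module.End A H) : Prop := Function.Bijective (towerEnd φ)

lemma isCompleteEnd_iff_isUnit (φ : Module.End A H) :
    IsCompleteEnd φ ↔ IsUnit (towerEnd φ) :=
  (Module.End.isUnit_iff _).symm

lemma IsCompleteEnd.eq_zero {φ : Module.End A H} (h : IsCompleteEnd φ) (x : ℕ → H)
    (hx : ∀ n, x n = φ (x (n + 1))) : x = 0 :=
  h.1 (by ext n; simp [hx n])

lemma IsCompleteEnd.ext {φ : Module.End A H} (h : IsCompleteEnd φ) (x y : ℕ → H)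
    (hxy : ∀ n, x n - φ (x (n + 1)) = y n - φ (y (n + 1))) : x = y :=
  h.1 (by ext n; simp [hxy n])

/-- If `φ` is complete and commutes with `θ`, then `1 - φ θ` is invertible. The inverse takes `y` to
the zeroth term of the solution of `zₙ - φ zₙ₊₁ = θⁿ y`, which stands for `∑ φⁿ θⁿ y`. -/
lemma IsCompleteEnd.isUnit_one_sub_mul {φ θ : Module.End A H} (h : IsCompleteEnd φ)
    (hc : Commute φ θ) : IsUnit (1 - φ * θ) := by
  have hc' : ∀ x, θ (φ x) = φ (θ x) := fun x => congrArg (fun u => u x) hc.eq.symm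
  rw [Module.End.isUnit_iff]
  constructor
  · rw [injective_iff_map_eq_zero]
    intro y hy
    have hy : y = φ (θ y) := sub_eq_zero.mp hy
    refine congrFun (h.eq_zero (fun n => (θ ^ n) y) fun n => ?_) 0
    have : (θ ^ n) (φ (θ y)) = φ ((θ ^ n) (θ y)) :=
      congrArg (fun u => u (θ y)) (hc.pow_right n).eq.symm
    rw [pow_succ, Module.End.mul_apply, ← this, ← hy]
  · intro y
    obtain ⟨z, hz⟩ := h.2 fun n => (θ ^ n) y
    have hz' : ∀ n, z n - φ (z (n + 1)) = (θ ^ n) y := fun n => congrFun hz n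
    -- `θ zₙ` and `zₙ₊₁` solve the same recursion.
    have key : (fun n => z (n + 1)) = fun n => θ (z n) := by
      refine h.ext _ _ fun n => ?_
      rw [hz', ← hc', ← map_sub, hz', pow_succ', Module.End.mul_apply]
    refine ⟨z 0, ?_⟩
    have h1 : z 1 = θ (z 0) := congrFun key 0
    have h0 := hz' 0
    rw [zero_add, h1] at h0
    simpa using h0

lemma seqEnd_mul (φ ψ : Module.End A H) : seqEnd (φ * ψ) = seqEnd φ * seqEnd ψ := rfl

lemma seqEnd_add (φ ψ : Module.End A H) : seqEnd (φ + ψ) = seqEnd φ + seqEnd ψ := rfl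

lemma commute_seqEnd_seqShift (φ : Module.End A H) : Commute (seqEnd φ) (seqShift A H) := rfl

lemma commute_seqEnd {φ ψ : Module.End A H} (h : Commute φ ψ) :
    Commute (seqEnd φ) (seqEnd ψ) := by
  rw [commute_iff_eq, ← seqEnd_mul, h.eq, seqEnd_mul]

lemma IsCompleteEnd.termwise {φ : Module.End A H} (h : IsCompleteEnd φ) :
    IsCompleteEnd (seqEnd φ) := by
  constructor
  · intro x y hxy
    ext n k
    refine congrFun (h.ext (fun n => x n k) (fun n => y n k) fun n => ?_) n
    exact congrFun (congrFun hxy n) k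
  · intro y
    choose x hx using fun k => h.2 fun n => y n k
    exact ⟨fun n k => x k n, by ext n k; exact congrFun (hx k) n⟩

lemma IsCompleteEnd.mul {φ θ : Module.End A H} (h : IsCompleteEnd φ) (hc : Commute φ θ) :
    IsCompleteEnd (φ * θ) := by
  rw [isCompleteEnd_iff_isUnit, towerEnd, seqEnd_mul, mul_assoc]
  exact h.termwise.isUnit_one_sub_mul ((commute_seqEnd hc).mul_right (commute_seqEnd_seqShift φ))

lemma IsCompleteEnd.add {φ ψ : Module.End A H} (hφ : IsCompleteEnd φ) (hψ : IsCompleteEnd ψ)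
    (hc : Commute φ ψ) : IsCompleteEnd (φ + ψ) := by
  obtain ⟨u, hu⟩ := (isCompleteEnd_iff_isUnit φ).1 hφ
  have c1 : Commute (seqEnd ψ) (towerEnd φ) :=
    (Commute.one_right _).sub_right
      ((commute_seqEnd hc.symm).mul_right (commute_seqEnd_seqShift ψ))
  have c2 : Commute (seqEnd ψ) (seqShift A H * ↑u⁻¹) :=
    (commute_seqEnd_seqShift ψ).mul_right (Commute.units_inv_right (hu ▸ c1))
  have hunit := hψ.termwise.isUnit_one_sub_mul c2
  -- `1 - (φ + ψ) s = (1 - ψ (s (1 - φ s)⁻¹)) (1 - φ s)`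
  have : towerEnd (φ + ψ) =
      (1 - seqEnd ψ * (seqShift A H * ↑u⁻¹)) * ↑u := by
    rw [sub_mul, one_mul, mul_assoc, mul_assoc, Units.inv_mul, mul_one, hu, towerEnd, towerEnd,
      seqEnd_add, add_mul, sub_sub]
  rw [isCompleteEnd_iff_isUnit, this]
  exact hunit.mul u.isUnit

variable {H₁ H₂ H₃ H₄ H₅ : Type*} [AddCommGroup H₁] [Module A H₁] [AddCommGroup H₂] [Module A H₂]
  [AddCommGroup H₃] [Module A H₃] [AddCommGroup H₄] [Module A H₄] [AddCommGroup H₅] [Module A H₅]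

lemma exact_compLeft {f : H₁ →ₗ[A] H₂} {g : H₂ →ₗ[A] H₃} (h : Function.Exact f g) :
    Function.Exact (f.compLeft ℕ) (g.compLeft ℕ) := by
  intro y
  constructor
  · intro hy
    choose x hx using fun n => (h (y n)).1 (congrFun hy n)
    exact ⟨x, funext hx⟩
  · rintro ⟨x, rfl⟩
    ext n
    exact (h _).2 ⟨_, rfl⟩

/-- The five lemma for completeness: an endomorphism of an exact sequence is complete in the middle
if it is complete at the four outer places. -/
lemma IsCompleteEnd.of_exact {f₁ : H₁ →ₗ[A] H₂} {f₂ : H₂ →ₗ[A] H₃} {f₃ : H₃ →ₗ[A] H₄}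
    {f₄ : H₄ →ₗ[A] H₅} (e₁ : Function.Exact f₁ f₂) (e₂ : Function.Exact f₂ f₃)
    (e₃ : Function.Exact f₃ f₄) {φ₁ : Module.End A H₁} {φ₂ : Module.End A H₂}
    {φ₃ : Module.End A H₃} {φ₄ : Module.End A H₄} {φ₅ : Module.End A H₅}
    (c₁ : ∀ x, φ₂ (f₁ x) = f₁ (φ₁ x)) (c₂ : ∀ x, φ₃ (f₂ x) = f₂ (φ₂ x))
    (c₃ : ∀ x, φ₄ (f₃ x) = f₃ (φ₃ x)) (c₄ : ∀ x, φ₅ (f₄ x) = f₄ (φ₄ x))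
    (h₁ : IsCompleteEnd φ₁) (h₂ : IsCompleteEnd φ₂) (h₄ : IsCompleteEnd φ₄)
    (h₅ : IsCompleteEnd φ₅) : IsCompleteEnd φ₃ := by
  refine LinearMap.bijective_of_surjective_of_bijective_of_bijective_of_injective
    (f₁.compLeft ℕ) (f₂.compLeft ℕ) (f₃.compLeft ℕ) (f₄.compLeft ℕ)
    (f₁.compLeft ℕ) (f₂.compLeft ℕ) (f₃.compLeft ℕ) (f₄.compLeft ℕ)
    (towerEnd φ₁) (towerEnd φ₂) (towerEnd φ₃) (towerEnd φ₄) (towerEnd φ₅)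
    ?_ ?_ ?_ ?_ (exact_compLeft e₁) (exact_compLeft e₂) (exact_compLeft e₃)
    (exact_compLeft e₁) (exact_compLeft e₂) (exact_compLeft e₃) h₁.2 h₂ h₄ h₅.1
  all_goals ext x n; simp [*]

lemma IsCompleteEnd.of_equiv (e : H₁ ≃ₗ[A] H₂) {φ₁ : Module.End A H₁} {φ₂ : Module.End A H₂}
    (c : ∀ x, φ₂ (e x) = e (φ₁ x)) (h : IsCompleteEnd φ₁) : IsCompleteEnd φ₂ := by
  have : ⇑(towerEnd φ₂) =
      e.toLinearMap.compLeft ℕ ∘ towerEnd φ₁ ∘ e.symm.toLinearMap.compLeft ℕ := by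
    ext x n
    simp [← c]
  unfold IsCompleteEnd
  rw [this]
  refine Function.Bijective.comp ?_ (h.comp ?_)
  · exact (Equiv.piCongrRight fun _ => e.toEquiv).bijective
  · exact (Equiv.piCongrRight fun _ => e.symm.toEquiv).bijective

variable (A H) in
/-- The right shift `(x₀, x₁, …) ↦ (0, x₀, x₁, …)`: multiplication by the variable if sequences are
viewed as power series. -/
def seqMulX : Module.End A (ℕ → H) where
  toFun x n := Nat.casesOn n 0 x
  map_add' x y := by ext n; cases n <;> simp
  map_smul' a x := by ext n; cases n <;> simp

@[simp] lemma seqMulX_zero (x : ℕ → H) : seqMulX A H x 0 = 0 := rfl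

@[simp] lemma seqMulX_succ (x : ℕ → H) (n : ℕ) : seqMulX A H x (n + 1) = x n := rfl

/-- The equation `xₙ - X xₙ₊₁ = yₙ` in power series determines the coefficients of all `xₙ` one
degree after the other. -/
lemma isCompleteEnd_seqMulX : IsCompleteEnd (seqMulX A H) := by
  constructor
  · rw [injective_iff_map_eq_zero]
    intro x hx
    have hx' : ∀ n k, x n k = seqMulX A H (x (n + 1)) k := fun n k =>
      sub_eq_zero.1 (congrFun (congrFun hx n) k)
    ext n k
    induction k generalizing n with
    | zero => exact hx' n 0
    | succ k ih => rw [hx', seqMulX_succ, ih]; rfl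
  · intro y
    let x : ℕ → ℕ → H := fun k =>
      Nat.rec (fun n => y n 0) (fun k xk n => y n (k + 1) + xk (n + 1)) k
    refine ⟨fun n k => x k n, ?_⟩
    ext n k
    cases k <;> simp [x]

end CompleteEnd

/-! ### Sequences in a complex -/

section Seq

variable {A : Type u} [CommRing A]

variable (A) in
/-- The exact functor sending a module `N` to the module of sequences in `N`. -/
@[simps]
def seqFunctor : ModuleCat.{u} A ⥤ ModuleCat.{u} A where
  obj N := ModuleCat.of A (ℕ → N)
  map f := ModuleCat.ofHom (f.hom.compLeft ℕ)

instance : (seqFunctor A).Additive where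

instance : (seqFunctor A).PreservesHomology := by
  refine (((seqFunctor A).exact_tfae).out 1 2).1 fun S hS => ?_
  rw [ShortComplex.ShortExact.moduleCat_exact_iff_function_exact] at hS ⊢
  exact exact_compLeft hS

/-- The complex of sequences in a complex `K`; it is a model for the product of copies of `K`. -/
abbrev Seq (K : Cplx A) : Cplx A :=
  ((seqFunctor A).mapHomologicalComplex (ComplexShape.up ℤ)).obj K

/-- The map on sequences induced by a map of complexes. -/
abbrev Seq.map {K L : Cplx A} (φ : K ⟶ L) : Seq K ⟶ Seq L :=
  ((seqFunctor A).mapHomologicalComplex (ComplexShape.up ℤ)).map φ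

/-- The endomorphism of `Seq K` induced by a natural operation on sequences. -/
abbrev Seq.nat (α : seqFunctor A ⟶ seqFunctor A) (K : Cplx A) : Seq K ⟶ Seq K :=
  (NatTrans.mapHomologicalComplex α (ComplexShape.up ℤ)).app K

/-- Cohomology commutes with the formation of sequences. -/
def homologySeqIso (K : Cplx A) (n : ℤ) :
    (Seq K).homology n ≅ (seqFunctor A).obj (K.homology n) :=
  (K.sc n).mapHomologyIso (seqFunctor A)

lemma homologySeqIso_naturality {K L : Cplx A} (φ : K ⟶ L) (n : ℤ) :
    HomologicalComplex.homologyMap (Seq.map φ) n ≫ (homologySeqIso L n).hom =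
      (homologySeqIso K n).hom ≫ (seqFunctor A).map (HomologicalComplex.homologyMap φ n) :=
  ShortComplex.mapHomologyIso_hom_naturality
    ((HomologicalComplex.shortComplexFunctor _ _ n).map φ) (seqFunctor A)

lemma homologySeqIso_nat (α : seqFunctor A ⟶ seqFunctor A) (K : Cplx A) (n : ℤ) :
    HomologicalComplex.homologyMap (Seq.nat α K) n ≫ (homologySeqIso K n).hom =
      (homologySeqIso K n).hom ≫ α.app (K.homology n) := by
  have := NatTrans.app_homology α (K.sc n)
  have e : HomologicalComplex.homologyMap (Seq.nat α K) n =
    ShortComplex.homologyMap ((K.sc n).mapNatTrans α) := rfl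
  rw [e]
  change α.app (K.sc n).homology = _ at this
  change _ = _ ≫ α.app (K.sc n).homology
  rw [this]
  exact (Iso.hom_inv_id_assoc ((K.sc n).mapHomologyIso (seqFunctor A)) _).symm

variable (A) in
/-- The left shift of sequences, as a natural operation. -/
@[simps]
def natShift : seqFunctor A ⟶ seqFunctor A where
  app N := ModuleCat.ofHom (seqShift A N)

variable (A) in
/-- The right shift of sequences, as a natural operation. -/
@[simps]
def natMulX : seqFunctor A ⟶ seqFunctor A where
  app N := ModuleCat.ofHom (seqMulX A N)
  naturality N N' f := by ext x; funext n; cases n; exacts [(map_zero f.hom).symm, rfl]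

/-- The operation `(xₙ)ₙ ↦ (xₙ - f xₙ₊₁)ₙ`. -/
abbrev natTower (f : A) : seqFunctor A ⟶ seqFunctor A := 𝟙 _ - f • natShift A

/-- Multiplication by `f` on a module is complete. -/
abbrev IsCompleteFor (f : A) (H : Type*) [AddCommGroup H] [Module A H] : Prop :=
  IsCompleteEnd (algebraMap A (Module.End A H) f)

lemma natTower_app_hom (f : A) (N : ModuleCat.{u} A) :
    ((natTower f).app N).hom = towerEnd (algebraMap A (Module.End A N) f) := by
  rfl

/-- On cohomology, the tower map of `Seq K` is the tower map of the cohomology of `K`. -/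
lemma quasiIso_seqTower_iff (f : A) (K : Cplx A) :
    QuasiIso (Seq.nat (natTower f) K) ↔ ∀ n, IsCompleteFor f (K.homology n) := by
  rw [quasiIso_iff]
  refine forall_congr' fun n => ?_
  have h := homologySeqIso_nat (natTower f) K n
  rw [quasiIsoAt_iff_isIso_homologyMap, ← isIso_comp_right_iff _ (homologySeqIso K n).hom, h,
    isIso_comp_left_iff, ConcreteCategory.isIso_iff_bijective]
  exact iff_of_eq (congrArg (fun φ : Module.End A (ℕ → K.homology n) => Function.Bijective φ)
    (natTower_app_hom f (K.homology n)))

/-- The `n`-th term of sequences. -/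
@[simps]
def natEval (n : ℕ) : seqFunctor A ⟶ 𝟭 _ where
  app N := ModuleCat.ofHom (LinearMap.proj n)

/-- The complex of sequences is the product of copies of the complex. -/
def seqFan (K : Cplx A) : Fan fun _ : ℕ => K :=
  Fan.mk (Seq K) fun n =>
    { f := fun i => (natEval n).app (K.X i)
      comm' := fun i j _ => ((natEval n).naturality (K.d i j)).symm }

/-- The universal property of `seqFan K`. -/
def seqFanIsLimit (K : Cplx A) : IsLimit (seqFan K) :=
  Fan.IsLimit.mk _
    (fun s =>
      { f := fun i => ModuleCat.ofHom (LinearMap.pi fun n => ((s.proj n).f i).hom)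
        comm' := fun i j _ => by
          ext x
          funext n
          exact (congrArg (fun u => u.hom x) ((s.proj n).comm i j)) })
    (fun s n => by ext i x; rfl)
    (fun s m hm => by
      ext i x
      funext n
      exact congrArg (fun u => (u.f i).hom x) (hm n))

/-- The product of copies of `K` agrees with the complex of sequences. -/
def piSeqIso (K : Cplx A) : (∏ᶜ fun _ : ℕ => K) ≅ Seq K :=
  (limit.isLimit _).conePointUniqueUpToIso (seqFanIsLimit K)

lemma piSeqIso_inv_π (K : Cplx A) (n : ℕ) :
    (piSeqIso K).inv ≫ Pi.π (fun _ : ℕ => K) n = (seqFan K).proj n :=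
  (limit.isLimit _).conePointUniqueUpToIso_inv_comp (seqFanIsLimit K) ⟨n⟩

lemma towerMap_piSeqIso (f : A) (K : Cplx A) :
    (piSeqIso K).inv ≫ towerMap f K = Seq.nat (natTower f) K ≫ (piSeqIso K).inv := by
  refine Pi.hom_ext _ _ fun n => ?_
  rw [Category.assoc, Category.assoc, piSeqIso_inv_π, towerMap, Pi.lift_π, Preadditive.comp_sub,
    Linear.comp_smul, piSeqIso_inv_π, piSeqIso_inv_π]
  ext i x
  rfl

lemma quasiIso_towerMap_iff (f : A) (K : Cplx A) :
    QuasiIso (towerMap f K) ↔ ∀ n, IsCompleteFor f (K.homology n) := by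
  rw [← quasiIso_seqTower_iff, ← quasiIso_iff_comp_left (piSeqIso K).inv, towerMap_piSeqIso,
    quasiIso_iff_comp_right]

end Seq

/-! ### Completeness and invertibility on cohomology -/

section Cohomology

variable {A : Type u} [CommRing A]

open HomologicalComplex

lemma homologyMap_smul {K L : Cplx A} (f : A) (φ : K ⟶ L) (n : ℤ) :
    homologyMap (f • φ) n = f • homologyMap φ n :=
  ShortComplex.homologyMap_smul ((shortComplexFunctor _ _ n).map φ) f

lemma homologyMap_smul_id_hom (f : A) (K : Cplx A) (n : ℤ) :
    (homologyMap (f • 𝟙 K) n).hom = algebraMap A (Module.End A (K.homology n)) f := by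
  rw [homologyMap_smul, homologyMap_id]
  rfl

/-- An endomorphism of a complex is complete if it is so on cohomology. -/
def IsCompleteOn {K : Cplx A} (φ : K ⟶ K) : Prop :=
  ∀ n, IsCompleteEnd (homologyMap φ n).hom

/-- The element `f` acts completely on the cohomology of `K`. -/
def HCompleteFor (f : A) (K : Cplx A) : Prop :=
  ∀ n, IsCompleteFor f (K.homology n)

/-- The element `f` acts bijectively on the cohomology of `K`. -/
def HInvertibleFor (f : A) (K : Cplx A) : Prop :=
  ∀ n, IsUnit (algebraMap A (Module.End A (K.homology n)) f)

lemma hCompleteFor_iff (f : A) (K : Cplx A) : HCompleteFor f K ↔ IsCompleteOn (f • 𝟙 K) := by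
  simp only [HCompleteFor, IsCompleteOn, homologyMap_smul_id_hom]

lemma IsCompleteOn.of_shortExact {S : ShortComplex (Cplx A)} (hS : S.ShortExact) (φ : S ⟶ S)
    (h₁ : IsCompleteOn φ.τ₁) (h₃ : IsCompleteOn φ.τ₃) : IsCompleteOn φ.τ₂ := by
  intro n
  have hn : (ComplexShape.up ℤ).Rel (n - 1) n := by simp
  have hn' : (ComplexShape.up ℤ).Rel n (n + 1) := by simp
  have e₁ := (ShortComplex.ShortExact.moduleCat_exact_iff_function_exact _).1
    (hS.homology_exact₁ (n - 1) n hn)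
  have e₂ := (ShortComplex.ShortExact.moduleCat_exact_iff_function_exact _).1
    (hS.homology_exact₂ n)
  have e₃ := (ShortComplex.ShortExact.moduleCat_exact_iff_function_exact _).1
    (hS.homology_exact₃ n (n + 1) hn')
  have nat : ∀ {X Y : ModuleCat.{u} A} {f g : X ⟶ Y}, f = g → ∀ x, f.hom x = g.hom x :=
    fun h x => by rw [h]
  refine IsCompleteEnd.of_exact e₁ e₂ e₃ (φ₁ := (homologyMap φ.τ₃ (n - 1)).hom)
    (φ₂ := (homologyMap φ.τ₁ n).hom) (φ₄ := (homologyMap φ.τ₃ n).hom)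
    (φ₅ := (homologyMap φ.τ₁ (n + 1)).hom) ?_ ?_ ?_ ?_ (h₃ _) (h₁ _) (h₃ _) (h₁ _)
  · exact nat (HomologySequence.δ_naturality φ hS hS (n - 1) n hn)
  · refine nat (f := homologyMap S.f n ≫ homologyMap φ.τ₂ n)
      (g := homologyMap φ.τ₁ n ≫ homologyMap S.f n) ?_
    rw [← homologyMap_comp, ← homologyMap_comp, φ.comm₁₂]
  · refine nat (f := homologyMap S.g n ≫ homologyMap φ.τ₃ n)
      (g := homologyMap φ.τ₂ n ≫ homologyMap S.g n) ?_
    rw [← homologyMap_comp, ← homologyMap_comp, φ.comm₂₃]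
  · exact nat (HomologySequence.δ_naturality φ hS hS n (n + 1) hn')

lemma IsCompleteOn.shift {K : Cplx A} {φ : K ⟶ K} (h : IsCompleteOn φ) :
    IsCompleteOn (φ⟦(1 : ℤ)⟧') := by
  intro n
  let e := (CochainComplex.ShiftSequence.shiftIso (ModuleCat.{u} A) 1 n (1 + n) rfl)
  refine IsCompleteEnd.of_equiv (e.app K).symm.toLinearEquiv (φ₁ := (homologyMap φ (1 + n)).hom)
    (fun x => ?_) (h _)
  exact congrArg (fun u => u.hom x) (e.inv.naturality φ).symm

open CochainComplex

/-- The endomorphism of the sequence `L ⟶ cone φ ⟶ K⟦1⟧` induced by endomorphisms of `K` and `L`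
that are compatible with `φ`. -/
def coneSequenceMap {K L : Cplx A} (φ : K ⟶ L) (a : K ⟶ K) (b : L ⟶ L) (comm : φ ≫ b = a ≫ φ) :
    mappingCone.triangleRotateShortComplex φ ⟶ mappingCone.triangleRotateShortComplex φ where
  τ₁ := b
  τ₂ := mappingCone.map φ φ a b comm
  τ₃ := a⟦(1 : ℤ)⟧'
  comm₁₂ := (mappingCone.triangleMap φ φ a b comm).comm₂.symm
  comm₂₃ := (mappingCone.triangleMap φ φ a b comm).comm₃.symm

lemma coneSequence_shortExact {K L : Cplx A} (φ : K ⟶ L) :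
    (mappingCone.triangleRotateShortComplex φ).ShortExact :=
  shortExact_of_degreewise_shortExact _
    fun n => (mappingCone.triangleRotateShortComplexSplitting φ n).shortExact

lemma IsCompleteOn.cone {K L : Cplx A} {φ : K ⟶ L} {a : K ⟶ K} {b : L ⟶ L}
    (comm : φ ≫ b = a ≫ φ) (ha : IsCompleteOn a) (hb : IsCompleteOn b) :
    IsCompleteOn (mappingCone.map φ φ a b comm) :=
  IsCompleteOn.of_shortExact (coneSequence_shortExact φ) (coneSequenceMap φ a b comm) hb ha.shift

/-- An endomorphism of a complex acts on its own cone by a map homotopic to zero. -/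
def coneSelfHomotopy {K : Cplx A} (φ : K ⟶ K) :
    Homotopy (mappingCone.map φ φ φ φ rfl) 0 :=
  mappingCone.descHomotopy φ _ _ 0 (mappingCone.inl φ) (by simp [mappingCone.map])
    (by simp [mappingCone.map])

lemma homologyMap_cone_self {K : Cplx A} (φ : K ⟶ K) (n : ℤ) :
    homologyMap (mappingCone.map φ φ φ φ rfl) n = 0 := by
  rw [(coneSelfHomotopy φ).homologyMap_eq, homologyMap_zero]

/-- The map induced on cones is additive in the pair of maps inducing it. -/
lemma cone_map_sub {K L : Cplx A} (φ : K ⟶ L) {a a' : K ⟶ K} {b b' : L ⟶ L}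
    (h : φ ≫ b = a ≫ φ) (h' : φ ≫ b' = a' ≫ φ) :
    mappingCone.map φ φ (a - a') (b - b') (by simp [h, h']) =
      mappingCone.map φ φ a b h - mappingCone.map φ φ a' b' h' := by
  refine hom_ext _ _ fun n => ?_
  simp [mappingCone.ext_from_iff φ (n + 1) n rfl, mappingCone.map]

lemma cone_map_smul {K L : Cplx A} (φ : K ⟶ L) {a : K ⟶ K} {b : L ⟶ L}
    (h : φ ≫ b = a ≫ φ) (f : A) :
    mappingCone.map φ φ (f • a) (f • b) (by simp [h]) = f • mappingCone.map φ φ a b h := by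
  refine hom_ext _ _ fun n => ?_
  simp [mappingCone.ext_from_iff φ (n + 1) n rfl, mappingCone.map]

end Cohomology

/-! ### The completion with respect to one element -/

section Completion

variable {A : Type u} [CommRing A]

open HomologicalComplex CochainComplex

/-- Multiplication by `x - f` on sequences, viewed as power series in the variable `x`. -/
abbrev natVarSub (f : A) : seqFunctor A ⟶ seqFunctor A := natMulX A - f • 𝟙 _

/-- The derived completion of `M` with respect to `f`: the derived quotient of the power series
`M⟦x⟧` by `x - f`. -/
abbrev completionAt (f : A) (M : Cplx A) : Cplx A := mappingCone (Seq.nat (natVarSub f) M)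

/-- The cofibre of `M ⟶ completionAt f M`: the tower of multiplications by `f`, shifted by one. -/
abbrev towerCone (f : A) (M : Cplx A) : Cplx A := mappingCone (Seq.nat (natTower f) M)

lemma isCompleteOn_seqMulX (M : Cplx A) : IsCompleteOn (Seq.nat (natMulX A) M) := by
  intro n
  refine IsCompleteEnd.of_equiv (homologySeqIso M n).symm.toLinearEquiv (fun x => ?_)
    (isCompleteEnd_seqMulX (H := M.homology n))
  have : (homologySeqIso M n).inv ≫ homologyMap (Seq.nat (natMulX A) M) n =
      (natMulX A).app (M.homology n) ≫ (homologySeqIso M n).inv := by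
    rw [Iso.inv_comp_eq, ← Category.assoc, Iso.eq_comp_inv, homologySeqIso_nat]
  exact congrArg (fun u => u.hom x) this

lemma IsCompleteOn.seqMap {M : Cplx A} {φ : M ⟶ M} (h : IsCompleteOn φ) :
    IsCompleteOn (Seq.map φ) := by
  intro n
  refine IsCompleteEnd.of_equiv (homologySeqIso M n).symm.toLinearEquiv (fun x => ?_)
    (h n).termwise
  have : (homologySeqIso M n).inv ≫ homologyMap (Seq.map φ) n =
      (seqFunctor A).map (homologyMap φ n) ≫ (homologySeqIso M n).inv := by
    rw [Iso.inv_comp_eq, ← Category.assoc, Iso.eq_comp_inv, homologySeqIso_naturality]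
  exact congrArg (fun u => u.hom x) this

lemma hCompleteFor_completionAt (f : A) (M : Cplx A) : HCompleteFor f (completionAt f M) := by
  rw [hCompleteFor_iff]
  let τ := Seq.nat (natVarSub f) M
  let x := Seq.nat (natMulX A) M
  have hτ : x - τ = f • 𝟙 _ := by
    refine hom_ext _ _ fun i => ?_
    exact sub_sub_cancel ((natMulX A).app (M.X i)) (f • 𝟙 _)
  have hx : τ ≫ x = x ≫ τ := by
    rw [← sub_sub_cancel x τ, hτ]
    simp
  have h : IsCompleteOn (mappingCone.map τ τ x x hx) :=
    IsCompleteOn.cone hx (isCompleteOn_seqMulX M) (isCompleteOn_seqMulX M)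
  -- On the cone of `x - f`, multiplication by `f` and by `x` agree up to homotopy.
  have key : mappingCone.map τ τ x x hx - mappingCone.map τ τ τ τ rfl = f • 𝟙 _ := by
    rw [← cone_map_sub, ← mappingCone.map_id, ← cone_map_smul]
    congr 1
  intro n
  have := h n
  rw [← key, sub_eq_add_neg, homologyMap_add, homologyMap_neg, homologyMap_cone_self, neg_zero,
    add_zero]
  exact this

lemma HCompleteFor.completionAt {p : A} {M : Cplx A} (h : HCompleteFor p M) (f : A) :
    HCompleteFor p (completionAt f M) := by
  rw [hCompleteFor_iff] at h ⊢
  have h' : IsCompleteOn (p • 𝟙 (Seq M)) := by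
    have := h.seqMap
    rwa [show Seq.map (p • 𝟙 M) = p • 𝟙 (Seq M) by ext i y; rfl] at this
  have := IsCompleteOn.cone (φ := Seq.nat (natVarSub f) M) (a := p • 𝟙 _) (b := p • 𝟙 _)
    (by simp) h' h'
  rw [cone_map_smul _ (by simp), mappingCone.map_id] at this
  exact this

lemma hInvertibleFor_towerCone (f : A) (M : Cplx A) : HInvertibleFor f (towerCone f M) := by
  intro n
  let t := Seq.nat (natTower f) M
  let s := Seq.nat (natShift A) M
  have ht : f • s = 𝟙 _ - t := by
    refine hom_ext _ _ fun i => ?_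
    exact (sub_sub_cancel (𝟙 _) (f • (natShift A).app (M.X i))).symm
  have hs : t ≫ s = s ≫ t := by
    rw [← sub_sub_cancel (𝟙 _) t, ← ht]
    simp
  -- On the cone of `1 - f s`, the shift `s` is inverse to `f` up to homotopy.
  have key : f • mappingCone.map t t s s hs = 𝟙 _ - mappingCone.map t t t t rfl := by
    rw [← cone_map_smul, ← mappingCone.map_id, ← cone_map_sub]
    congr 1
  have hn : f • homologyMap (mappingCone.map t t s s hs) n = 𝟙 _ := by
    rw [← homologyMap_smul, key, sub_eq_add_neg, homologyMap_add, homologyMap_neg,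
      homologyMap_cone_self, neg_zero, add_zero, homologyMap_id]
  have hn' : algebraMap A (Module.End A _) f * (homologyMap (mappingCone.map t t s s hs) n).hom
      = 1 := by
    ext z
    exact congrArg (fun u => u.hom z) hn
  exact isUnit_iff_exists.2 ⟨_, hn', (Algebra.commutes f _).symm.trans hn'⟩

variable (A) in
/-- The sequences concentrated in degree zero: the constant power series. -/
@[simps]
def natConst : 𝟭 (ModuleCat.{u} A) ⟶ seqFunctor A where
  app N := ModuleCat.ofHom (LinearMap.single A (fun _ : ℕ => (N : Type u)) 0)
  naturality N N' φ := by
    ext x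
    funext n
    cases n
    exacts [rfl, (map_zero φ.hom).symm]

/-- Constant power series in a complex. -/
def seqConst (M : Cplx A) : M ⟶ Seq M where
  f i := (natConst A).app (M.X i)
  comm' i j _ := ((natConst A).naturality (M.d i j)).symm

/-- The canonical map from `M` to its completion. -/
def toCompletionAt (f : A) (M : Cplx A) : M ⟶ completionAt f M := seqConst M ≫ mappingCone.inr _

/-- Removing the constant term of a power series carries `x - f` to `1 - f s`. -/
def completionAtToTowerCone (f : A) (M : Cplx A) : completionAt f M ⟶ towerCone f M :=
  mappingCone.map _ _ (𝟙 _) (Seq.nat (natShift A) M) (by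
    ext i y
    simp
    rfl)

lemma seqConst_shift (M : Cplx A) : seqConst M ≫ Seq.nat (natShift A) M = 0 := by
  ext i y
  rfl

/-- The sequence `M ⟶ completionAt f M ⟶ towerCone f M`. -/
def completionSequence (f : A) (M : Cplx A) : ShortComplex (Cplx A) :=
  ShortComplex.mk (toCompletionAt f M) (completionAtToTowerCone f M) (by
    simp [toCompletionAt, completionAtToTowerCone, mappingCone.map, reassoc_of% seqConst_shift])

lemma inr_completionAtToTowerCone (f : A) (M : Cplx A) (n : ℤ) :
    (mappingCone.inr (Seq.nat (natVarSub f) M)).f n ≫ (completionAtToTowerCone f M).f n =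
      (Seq.nat (natShift A) M).f n ≫ (mappingCone.inr (Seq.nat (natTower f) M)).f n := by
  rw [completionAtToTowerCone, mappingCone.map, mappingCone.inr_f_desc_f, comp_f]

lemma inl_completionAtToTowerCone (f : A) (M : Cplx A) (n : ℤ) :
    (mappingCone.inl (Seq.nat (natVarSub f) M)).v (n + 1) n (by simp) ≫
        (completionAtToTowerCone f M).f n =
      (mappingCone.inl (Seq.nat (natTower f) M)).v (n + 1) n (by simp) := by
  simp [completionAtToTowerCone, mappingCone.map]

/-- A splitting of `N ⟶ F ⊞ S ⟶ F ⊞ S`, where the maps are the identity on `F` and come from a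
splitting `c, e, s, m` of `N ⟶ S ⟶ S`. -/
def splittingOfBiproducts {C : Type*} [Category* C] [Preadditive C] {N S F X Y : C}
    {i : F ⟶ X} {j : S ⟶ X} {a : X ⟶ F} {b : X ⟶ S} (jb : j ≫ b = 𝟙 _)
    (hX : a ≫ i + b ≫ j = 𝟙 _)
    {i' : F ⟶ Y} {j' : S ⟶ Y} {a' : Y ⟶ F} {b' : Y ⟶ S} (ia' : i' ≫ a' = 𝟙 _)
    (ib' : i' ≫ b' = 0) (ja' : j' ≫ a' = 0) (jb' : j' ≫ b' = 𝟙 _)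
    (hY : a' ≫ i' + b' ≫ j' = 𝟙 _) {c : N ⟶ S} {e : S ⟶ N} {s : S ⟶ S} {m : S ⟶ S}
    (ce : c ≫ e = 𝟙 _) (ms : m ≫ s = 𝟙 _) (hS : e ≫ c + s ≫ m = 𝟙 _)
    {f : N ⟶ X} (hf : f = c ≫ j) {g : X ⟶ Y} (ig : i ≫ g = i') (jg : j ≫ g = s ≫ j')
    (zero : f ≫ g = 0) : (ShortComplex.mk f g zero).Splitting where
  r := b ≫ e
  s := a' ≫ i + b' ≫ m ≫ j
  f_r := by simp [hf, reassoc_of% jb, ce]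
  s_g := by simp [ig, jg, reassoc_of% ms, hY]
  id := by
    have hg : g = a ≫ i' + b ≫ s ≫ j' := by
      rw [← Category.id_comp g, ← hX, Preadditive.add_comp, Category.assoc, Category.assoc, ig, jg]
    have ga : g ≫ a' = a := by simp [hg, ia', ja']
    have gb : g ≫ b' = b ≫ s := by simp [hg, ib', jb']
    have : b ≫ e ≫ c ≫ j + b ≫ s ≫ m ≫ j = b ≫ j := by
      rw [← Preadditive.comp_add, ← Category.assoc e, ← Category.assoc s, ← Preadditive.add_comp,
        hS, Category.id_comp]
    simp only [hf, Category.assoc, Preadditive.comp_add, reassoc_of% ga, reassoc_of% gb]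
    rw [add_left_comm, this, hX]

/-- In each degree, a power series is the sum of its constant term and of `x` times its left
shift, which splits the sequence `M ⟶ completionAt f M ⟶ towerCone f M`. -/
def completionSequenceSplitting (f : A) (M : Cplx A) (n : ℤ) :
    ((completionSequence f M).map (HomologicalComplex.eval _ _ n)).Splitting :=
  splittingOfBiproducts
    (i := (mappingCone.inl (Seq.nat (natVarSub f) M)).v (n + 1) n (by simp))
    (a := (mappingCone.fst (Seq.nat (natVarSub f) M)).1.v n (n + 1) rfl)
    (b := (mappingCone.snd (Seq.nat (natVarSub f) M)).v n n (add_zero n))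
    (a' := (mappingCone.fst (Seq.nat (natTower f) M)).1.v n (n + 1) rfl)
    (b' := (mappingCone.snd (Seq.nat (natTower f) M)).v n n (add_zero n))
    (c := (natConst A).app (M.X n)) (e := (natEval 0).app (M.X n))
    (m := (natMulX A).app (M.X n)) (s := (natShift A).app (M.X n))
    (mappingCone.inr_f_snd_v _ n)
    (mappingCone.id_X _ n (n + 1) rfl)
    (mappingCone.inl_v_fst_v _ _ _ _) (mappingCone.inl_v_snd_v _ _ _ _)
    (mappingCone.inr_f_fst_v _ _ _ _) (mappingCone.inr_f_snd_v _ n)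
    (mappingCone.id_X _ n (n + 1) rfl) rfl rfl
    (by ext y; funext k; cases k; exacts [add_zero _, zero_add _])
    rfl (inl_completionAtToTowerCone f M n) (inr_completionAtToTowerCone f M n) _

lemma completionSequence_shortExact (f : A) (M : Cplx A) :
    (completionSequence f M).ShortExact :=
  shortExact_of_degreewise_shortExact _ fun n => (completionSequenceSplitting f M n).shortExact

end Completion

/-! ### Elements of tensor products of complexes -/

section Tensor

variable {A : Type u} [CommRing A]

open HomologicalComplex MonoidalCategory

/-- The total tensor product of two complexes. -/
abbrev tens (X P : Cplx A) : Cplx A := HomologicalComplex.tensorObj X P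

/-- The inclusion of a summand of the tensor product. -/
abbrev tensι (X P : Cplx A) {i j n : ℤ} (h : i + j = n) : X.X i ⊗ P.X j ⟶ (tens X P).X n :=
  ιTensorObj X P i j n h

/-- The projection to a summand of the tensor product. -/
def tensπ (X P : Cplx A) {i j n : ℤ} (h : i + j = n) : (tens X P).X n ⟶ X.X i ⊗ P.X j :=
  mapBifunctorDesc fun i' j' (h' : i' + j' = n) =>
    if hj : j' = j then eqToHom (by
      obtain rfl : i' = i := by omega
      subst hj
      rfl) else 0

variable {X P : Cplx A}

lemma tensι_tensπ {i j n : ℤ} (h : i + j = n) : tensι X P h ≫ tensπ X P h = 𝟙 _ := by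
  simp [tensπ]

lemma tensι_tensπ_assoc {i j n : ℤ} (h : i + j = n) {Y : ModuleCat.{u} A}
    (g : X.X i ⊗ P.X j ⟶ Y) : tensι X P h ≫ tensπ X P h ≫ g = g := by
  rw [← Category.assoc, tensι_tensπ, Category.id_comp]

lemma tensι_tensπ_of_ne {i j i' j' n : ℤ} (h : i + j = n) (h' : i' + j' = n) (hj : j ≠ j') :
    tensι X P h ≫ tensπ X P h' = 0 := by
  simp [tensπ, hj]

lemma tens_induction {n : ℤ} {p : (tens X P).X n → Prop} (zero : p 0)
    (add : ∀ x y, p x → p y → p (x + y))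
    (ι : ∀ (i j : ℤ) (h : i + j = n) (x : (X.X i ⊗ P.X j : ModuleCat.{u} A)),
      p ((tensι X P h).hom x)) (z : (tens X P).X n) : p z := by
  let S : Submodule A ((tens X P).X n) :=
    ⨆ ij : {ij : ℤ × ℤ // ij.1 + ij.2 = n}, LinearMap.range (tensι X P ij.2).hom
  have hS : ModuleCat.ofHom S.mkQ = 0 := by
    refine mapBifunctor.hom_ext fun i j h => ?_
    ext1
    refine LinearMap.ext fun x => ?_
    refine (Submodule.Quotient.mk_eq_zero S).2 ?_
    exact Submodule.mem_iSup_of_mem (⟨(i, j), h⟩ : {ij : ℤ × ℤ // ij.1 + ij.2 = n}) ⟨x, rfl⟩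
  have hz : z ∈ S := (Submodule.Quotient.mk_eq_zero S).1 (congrArg (fun u => u.hom z) hS)
  refine Submodule.iSup_induction _ (motive := p) hz ?_ zero add
  rintro ⟨⟨i, j⟩, h⟩ _ ⟨x, rfl⟩
  exact ι i j h x

lemma tensπ_tensι_apply {i j n : ℤ} (h : i + j = n) (x : (X.X i ⊗ P.X j : ModuleCat.{u} A)) :
    (tensπ X P h).hom ((tensι X P h).hom x) = x :=
  congrArg (fun u => u.hom x) (tensι_tensπ h)

lemma tensπ_tensι_apply_of_ne {i j i' j' n : ℤ} (h : i + j = n) (h' : i' + j' = n) (hj : j ≠ j')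
    (x : (X.X i ⊗ P.X j : ModuleCat.{u} A)) :
    (tensπ X P h').hom ((tensι X P h).hom x) = 0 :=
  congrArg (fun u => u.hom x) (tensι_tensπ_of_ne h h' hj)

/-- Every element of the tensor product is the finite sum of its components. -/
lemma exists_eq_sum {n : ℤ} (z : (tens X P).X n) : ∃ s : Finset ℤ, ∀ t, s ⊆ t →
    z = ∑ j ∈ t, (tensι X P (sub_add_cancel n j)).hom
      ((tensπ X P (sub_add_cancel n j)).hom z) := by
  refine tens_induction (p := fun z => ∃ s : Finset ℤ, ∀ t, s ⊆ t →
    z = ∑ j ∈ t, (tensι X P (sub_add_cancel n j)).hom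
      ((tensπ X P (sub_add_cancel n j)).hom z)) ⟨∅, fun t _ => ?_⟩ ?_ ?_ z
  · simp
  · rintro x y ⟨s, hs⟩ ⟨s', hs'⟩
    refine ⟨s ∪ s', fun t ht => ?_⟩
    simp only [map_add, Finset.sum_add_distrib]
    rw [← hs t (Finset.union_subset_left ht), ← hs' t (Finset.union_subset_right ht)]
  · rintro i j h x
    refine ⟨{j}, fun t ht => ?_⟩
    obtain rfl : i = n - j := by omega
    rw [Finset.sum_eq_single j, tensπ_tensι_apply]
    · intro k _ hk
      rw [tensπ_tensι_apply_of_ne _ _ hk.symm, map_zero]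
    · intro hj
      exact absurd (ht (Finset.mem_singleton_self j)) hj

lemma tens_ext {n : ℤ} {z z' : (tens X P).X n}
    (h : ∀ (i j : ℤ) (h : i + j = n), (tensπ X P h).hom z = (tensπ X P h).hom z') : z = z' := by
  obtain ⟨s, hs⟩ := exists_eq_sum z
  obtain ⟨s', hs'⟩ := exists_eq_sum z'
  rw [hs _ Finset.subset_union_left, hs' _ Finset.subset_union_right]
  exact Finset.sum_congr rfl fun j _ => by rw [h]

lemma exists_tensπ_eq_zero {n : ℤ} (z : (tens X P).X n) : ∃ k : ℕ, ∀ (i j : ℤ) (h : i + j = n),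
    j < 1 - k → (tensπ X P h).hom z = 0 := by
  refine tens_induction (p := fun z => ∃ k : ℕ, ∀ (i j : ℤ) (h : i + j = n),
    j < 1 - k → (tensπ X P h).hom z = 0) ⟨0, fun i j h _ => map_zero _⟩ ?_ ?_ z
  · rintro x y ⟨k, hk⟩ ⟨k', hk'⟩
    refine ⟨max k k', fun i j h hj => ?_⟩
    rw [map_add, hk i j h (by omega), hk' i j h (by omega), add_zero]
  · rintro i j h x
    refine ⟨(1 - j).toNat, fun i' j' h' hj' => tensπ_tensι_apply_of_ne _ _ (by omega) _⟩

/-- The differential of the tensor product on a summand. -/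
lemma tensι_d {i i' j j' n n' : ℤ} (hi : i + 1 = i') (hj : j + 1 = j') (hn : n + 1 = n')
    (h : i + j = n) :
    tensι X P h ≫ (tens X P).d n n' =
      ComplexShape.ε₁ (.up ℤ) (.up ℤ) (.up ℤ) (i, j) • (X.d i i' ▷ P.X j ≫
        tensι X P (by omega : i' + j = n')) +
      ComplexShape.ε₂ (.up ℤ) (.up ℤ) (.up ℤ) (i, j) • (X.X i ◁ P.d j j' ≫
        tensι X P (by omega : i + j' = n')) := by
  subst hi hj hn
  rw [mapBifunctor.d_eq, Preadditive.comp_add, mapBifunctor.ι_D₁, mapBifunctor.ι_D₂,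
    mapBifunctor.d₁_eq _ _ _ _ (show (ComplexShape.up ℤ).Rel i (i + 1) from rfl) _ _
      (show i + 1 + j = n + 1 by omega),
    mapBifunctor.d₂_eq _ _ _ _ _ (show (ComplexShape.up ℤ).Rel j (j + 1) from rfl) _
      (show i + (j + 1) = n + 1 by omega)]
  rfl

/-- The components of the differential of the tensor product. -/
lemma d_tensπ {i i' j j' n n' : ℤ} (hi : i + 1 = i') (hj : j + 1 = j') (hn : n + 1 = n')
    (h : i + j' = n) :
    (tens X P).d n n' ≫ tensπ X P (by omega : i' + j' = n') =
      ComplexShape.ε₁ (.up ℤ) (.up ℤ) (.up ℤ) (i, j') • (tensπ X P h ≫ X.d i i' ▷ P.X j') +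
      ComplexShape.ε₂ (.up ℤ) (.up ℤ) (.up ℤ) (i', j) •
        (tensπ X P (by omega : i' + j = n) ≫ X.X i' ◁ P.d j j') := by
  subst hi hj hn
  refine mapBifunctor.hom_ext fun a b (hab : a + b = n) => ?_
  change tensι X P hab ≫ _ = tensι X P hab ≫ _
  rw [← Category.assoc, tensι_d rfl rfl rfl, Preadditive.add_comp, Preadditive.comp_add,
    Linear.units_smul_comp, Linear.units_smul_comp, Linear.comp_units_smul, Linear.comp_units_smul,
    Category.assoc, Category.assoc]
  by_cases h₁ : b = j + 1
  · subst h₁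
    obtain rfl : a = i := by omega
    rw [tensι_tensπ, tensι_tensπ_of_ne _ _ (by omega), tensι_tensπ_assoc,
      ← Category.assoc (tensι X P _), tensι_tensπ_of_ne _ _ (by omega)]
    simp
  · by_cases h₂ : b = j
    · subst h₂
      obtain rfl : a = i + 1 := by omega
      rw [tensι_tensπ, tensι_tensπ_of_ne _ _ (by omega), tensι_tensπ_assoc,
        ← Category.assoc (tensι X P _), tensι_tensπ_of_ne _ _ (by omega)]
      simp
    · rw [tensι_tensπ_of_ne _ _ (by omega), tensι_tensπ_of_ne _ _ (by omega),
        ← Category.assoc (tensι X P _), ← Category.assoc (tensι X P _),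
        tensι_tensπ_of_ne _ _ (by omega), tensι_tensπ_of_ne _ _ (by omega)]
      simp

/-! ### Tensoring with a bounded above complex of flat modules -/

lemma exactAt_iff_exists (K : Cplx A) (n : ℤ) :
    K.ExactAt n ↔ ∀ z : K.X n, (K.d n (n + 1)).hom z = 0 → ∃ w, (K.d (n - 1) n).hom w = z := by
  rw [K.exactAt_iff' (n - 1) n (n + 1) (by simp) (by simp), ShortComplex.moduleCat_exact_iff]
  rfl

/-- If `X` is acyclic and `P` is a complex of flat modules in nonpositive degrees, then `X ⊗ P` is
acyclic: the component of a cocycle of lowest degree in `P` is a cocycle for the differential of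
`X`, hence can be removed by subtracting a coboundary. -/
lemma tens_acyclic (hX : X.Acyclic) (hP : ∀ j > 0, IsZero (P.X j))
    (hflat : ∀ j, Module.Flat A (P.X j)) : (tens X P).Acyclic := by
  suffices H : ∀ (k : ℕ) (n : ℤ) (z : (tens X P).X n), ((tens X P).d n (n + 1)).hom z = 0 →
      (∀ (i j : ℤ) (h : i + j = n), j < 1 - k → (tensπ X P h).hom z = 0) →
      ∃ w, ((tens X P).d (n - 1) n).hom w = z by
    intro n
    rw [exactAt_iff_exists]
    intro z hz
    obtain ⟨k, hk⟩ := exists_tensπ_eq_zero z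
    exact H k n z hz hk
  intro k
  induction k with
  | zero =>
    intro n z _ hz0
    refine ⟨0, (map_zero _).trans (tens_ext fun i j h => ?_)⟩
    rw [map_zero]
    by_cases hj : j < 1
    · exact (hz0 i j h (by simpa using hj)).symm
    · have : IsZero (X.X i ⊗ P.X j) :=
        Functor.map_isZero (tensorLeft (X.X i)) (hP j (by omega))
      have := ModuleCat.subsingleton_of_isZero this
      exact Subsingleton.elim _ _
  | succ k ih =>
    intro n z hz hz0
    let j : ℤ := -k
    let i : ℤ := n + k
    have hij : i + j = n := by omega
    set y := (tensπ X P hij).hom z with hy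
    have hy0 : (X.d i (i + 1) ▷ P.X j).hom y = 0 := by
      have h1 := congrArg (fun u => u.hom z)
        (d_tensπ (X := X) (P := P) (j := j - 1) rfl (by omega) rfl hij)
      have h2 := hz0 (i + 1) (j - 1) (by omega) (by omega)
      rcases Int.units_eq_one_or (ComplexShape.ε₁ (.up ℤ) (.up ℤ) (.up ℤ) (i, j)) with h | h <;>
      rcases Int.units_eq_one_or (ComplexShape.ε₂ (.up ℤ) (.up ℤ) (.up ℤ) (i + 1, j - 1))
        with h' | h' <;>
      simpa [h, h', hz, h2, hy]
        using h1.symm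
    have hex : Function.Exact (X.d (i - 1) i ▷ P.X j).hom (X.d i (i + 1) ▷ P.X j).hom := by
      have h1 := hX i
      rw [X.exactAt_iff' (i - 1) i (i + 1) (by simp) (by simp),
        ShortComplex.ShortExact.moduleCat_exact_iff_function_exact] at h1
      exact Module.Flat.rTensor_exact (P.X j) h1
    obtain ⟨w, hw⟩ := (hex y).1 hy0
    obtain ⟨ε, hε⟩ : ∃ ε, ε = ComplexShape.ε₁ (.up ℤ) (.up ℤ) (.up ℤ) (i - 1, j) := ⟨_, rfl⟩
    let w' := (tensι X P (by omega : i - 1 + j = n - 1)).hom ((ε : ℤ) • w)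
    have hd : ((tens X P).d (n - 1) n).hom w' = (tensι X P hij).hom y +
        ((ComplexShape.ε₂ (.up ℤ) (.up ℤ) (.up ℤ) (i - 1, j) * ε : ℤˣ) : ℤ) •
          (tensι X P (by omega : i - 1 + (j + 1) = n)).hom
            ((X.X (i - 1) ◁ P.d j (j + 1)).hom w) := by
      have h1 := congrArg (fun u => u.hom ((ε : ℤ) • w)) (tensι_d (X := X) (P := P)
        (by omega : i - 1 + 1 = i) (rfl : j + 1 = j + 1) (by omega : n - 1 + 1 = n) (by omega))
      rw [← hε] at h1
      refine h1.trans ?_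
      rcases Int.units_eq_one_or ε with h | h <;>
      simp [h, hw] <;> rfl
    have hz' : ((tens X P).d n (n + 1)).hom (z - ((tens X P).d (n - 1) n).hom w') = 0 := by
      rw [map_sub, hz, zero_sub, neg_eq_zero]
      exact congrArg (fun u => u.hom w') ((tens X P).d_comp_d (n - 1) n (n + 1))
    obtain ⟨v, hv⟩ := ih n _ hz' fun i' j' h' hj' => by
      rw [map_sub, hd, map_add, map_zsmul,
        tensπ_tensι_apply_of_ne (by omega : i - 1 + (j + 1) = n) h' (by omega), smul_zero, add_zero]
      by_cases hjj : j' = j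
      · subst hjj
        obtain rfl : i' = i := by omega
        rw [tensπ_tensι_apply, ← hy, sub_self]
      · rw [hz0 i' j' h' (by push_cast at hj' ⊢; omega), tensπ_tensι_apply_of_ne _ h' (Ne.symm hjj),
          sub_zero]
    exact ⟨v + w', by rw [map_add, hv, sub_add_cancel]⟩

end Tensor

/-! ### Tensor products and quasi-isomorphisms -/

section TensorMap

variable {A : Type u} [CommRing A]

open HomologicalComplex MonoidalCategory

/-- The map induced on total tensor products. -/
abbrev tensMap {X Z P Q : Cplx A} (φ : X ⟶ Z) (ψ : P ⟶ Q) : tens X P ⟶ tens Z Q :=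
  HomologicalComplex.tensorHom φ ψ

variable {X Z P Q : Cplx A}

/-- The component of `tensMap φ ψ` on a summand. -/
abbrev tensMapAt (φ : X ⟶ Z) (ψ : P ⟶ Q) (i j : ℤ) : X.X i ⊗ P.X j ⟶ Z.X i ⊗ Q.X j :=
  φ.f i ▷ P.X j ≫ Z.X i ◁ ψ.f j

lemma tensMapAt_id (φ : X ⟶ Z) (i j : ℤ) : tensMapAt φ (𝟙 P) i j = φ.f i ▷ P.X j := by
  simp [tensMapAt]

lemma tensι_tensMap (φ : X ⟶ Z) (ψ : P ⟶ Q) {i j n : ℤ} (h : i + j = n) :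
    tensι X P h ≫ (tensMap φ ψ).f n = tensMapAt φ ψ i j ≫ tensι Z Q h := by
  refine (ι_mapBifunctorMap φ ψ (curriedTensor _) _ i j n h).trans ?_
  exact (Category.assoc _ _ _).symm

lemma tensMap_tensπ (φ : X ⟶ Z) (ψ : P ⟶ Q) {i j n : ℤ} (h : i + j = n) :
    (tensMap φ ψ).f n ≫ tensπ Z Q h = tensπ X P h ≫ tensMapAt φ ψ i j := by
  refine mapBifunctor.hom_ext fun a b (hab : a + b = n) => ?_
  change tensι X P hab ≫ _ = tensι X P hab ≫ _
  rw [← Category.assoc, tensι_tensMap, Category.assoc, ← Category.assoc (tensι X P _)]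
  by_cases hb : b = j
  · subst hb
    obtain rfl : a = i := by omega
    rw [tensι_tensπ, tensι_tensπ, Category.comp_id, Category.id_comp]
  · rw [tensι_tensπ_of_ne _ _ hb, tensι_tensπ_of_ne _ _ hb, comp_zero, zero_comp]

lemma tensMap_tensι_apply (φ : X ⟶ Z) (ψ : P ⟶ Q) {i j n : ℤ} (h : i + j = n)
    (x : (X.X i ⊗ P.X j : ModuleCat.{u} A)) :
    ((tensMap φ ψ).f n).hom ((tensι X P h).hom x) =
      (tensι Z Q h).hom ((tensMapAt φ ψ i j).hom x) :=
  congrArg (fun u => u.hom x) (tensι_tensMap φ ψ h)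

lemma tensπ_tensMap_apply (φ : X ⟶ Z) (ψ : P ⟶ Q) {i j n : ℤ} (h : i + j = n)
    (z : (tens X P).X n) :
    (tensπ Z Q h).hom (((tensMap φ ψ).f n).hom z) =
      (tensMapAt φ ψ i j).hom ((tensπ X P h).hom z) :=
  congrArg (fun u => u.hom z) (tensMap_tensπ φ ψ h)

lemma tensMap_injective (φ : X ⟶ Z) (ψ : P ⟶ Q)
    (h : ∀ i j, Function.Injective (tensMapAt φ ψ i j).hom) (n : ℤ) :
    Function.Injective ((tensMap φ ψ).f n).hom := by
  intro z z' hz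
  refine tens_ext fun i j hij => h i j ?_
  rw [← tensπ_tensMap_apply, ← tensπ_tensMap_apply, hz]

lemma tensMap_surjective (φ : X ⟶ Z) (ψ : P ⟶ Q)
    (h : ∀ i j, Function.Surjective (tensMapAt φ ψ i j).hom) (n : ℤ) :
    Function.Surjective ((tensMap φ ψ).f n).hom := by
  intro z
  refine tens_induction (p := fun z => ∃ y, ((tensMap φ ψ).f n).hom y = z) ⟨0, map_zero _⟩ ?_ ?_ z
  · rintro _ _ ⟨x, rfl⟩ ⟨y, rfl⟩
    exact ⟨x + y, map_add _ _ _⟩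
  · intro i j hij x
    obtain ⟨y, rfl⟩ := h i j x
    exact ⟨_, tensMap_tensι_apply φ ψ hij y⟩

lemma tensMap_isIso (φ : X ⟶ Z) (ψ : P ⟶ Q)
    (h : ∀ i j, Function.Bijective (tensMapAt φ ψ i j).hom) : IsIso (tensMap φ ψ) := by
  have (n : ℤ) : IsIso ((tensMap φ ψ).f n) := by
    rw [ConcreteCategory.isIso_iff_bijective]
    exact ⟨tensMap_injective φ ψ (fun i j => (h i j).1) n,
      tensMap_surjective φ ψ (fun i j => (h i j).2) n⟩
  exact HomologicalComplex.Hom.isIso_of_components _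

/-- The total tensor products of the terms of a short complex with `P`. -/
abbrev tensShortComplex (S : ShortComplex (Cplx A)) (P : Cplx A) : ShortComplex (Cplx A) :=
  ShortComplex.mk (tensMap S.f (𝟙 P)) (tensMap S.g (𝟙 P)) (by
    refine hom_ext _ _ fun n => mapBifunctor.hom_ext fun i j (h : i + j = n) => ?_
    change tensι S.X₁ P h ≫ _ = tensι S.X₁ P h ≫ _
    have h0 : S.f.f i ≫ S.g.f i = 0 := by rw [← comp_f, S.zero, zero_f]
    rw [comp_f, ← Category.assoc, tensι_tensMap, Category.assoc, tensι_tensMap, zero_f, comp_zero]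
    simp [tensMapAt, ← comp_whiskerRight_assoc, h0])

/-- Tensoring with a complex of flat modules preserves short exact sequences. -/
lemma tensShortComplex_shortExact {S : ShortComplex (Cplx A)} (hS : S.ShortExact)
    (hflat : ∀ j, Module.Flat A (P.X j)) : (tensShortComplex S P).ShortExact := by
  refine shortExact_of_degreewise_shortExact _ fun n => ?_
  have hS' (i : ℤ) : (S.map (HomologicalComplex.eval _ _ i)).ShortExact :=
    hS.map_of_exact (HomologicalComplex.eval _ _ i)
  have inj (i : ℤ) : Function.Injective (S.f.f i).hom := (hS' i).moduleCat_injective_f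
  have surj (i : ℤ) : Function.Surjective (S.g.f i).hom := (hS' i).moduleCat_surjective_g
  have ex (i : ℤ) : Function.Exact (S.f.f i).hom (S.g.f i).hom :=
    (ShortComplex.ShortExact.moduleCat_exact_iff_function_exact _).1 (hS' i).exact
  have ex' (i j : ℤ) :
      Function.Exact (tensMapAt S.f (𝟙 P) i j).hom (tensMapAt S.g (𝟙 P) i j).hom := by
    rw [tensMapAt_id, tensMapAt_id]
    exact Module.Flat.rTensor_exact (P.X j) (ex i)
  refine ShortComplex.ShortExact.mk' ?_ ?_ ?_
  · rw [ShortComplex.ShortExact.moduleCat_exact_iff_function_exact]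
    intro (z : (tens S.X₂ P).X n)
    constructor
    · intro (hz : ((tensMap S.g (𝟙 P)).f n).hom z = 0)
      have hz' (j : ℤ) : ∃ y, (tensMapAt S.f (𝟙 P) (n - j) j).hom y =
          (tensπ S.X₂ P (sub_add_cancel n j)).hom z := by
        refine (ex' _ _ _).1 ?_
        rw [← tensπ_tensMap_apply, hz, map_zero]
      choose y hy using hz'
      obtain ⟨s, hs⟩ := exists_eq_sum z
      refine ⟨∑ j ∈ s, (tensι S.X₁ P (sub_add_cancel n j)).hom (y j), ?_⟩
      refine (map_sum ((tensMap S.f (𝟙 P)).f n).hom _ _).trans ?_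
      rw [hs s subset_rfl]
      exact Finset.sum_congr rfl fun j _ => by rw [tensMap_tensι_apply, hy]
    · rintro ⟨y, rfl⟩
      exact congrArg (fun u => (u.f n).hom y) (tensShortComplex S P).zero
  · rw [ModuleCat.mono_iff_injective]
    refine tensMap_injective S.f (𝟙 P) (fun i j => ?_) n
    rw [tensMapAt_id]
    exact Module.Flat.rTensor_preserves_injective_linearMap (M := P.X j) _ (inj i)
  · rw [ModuleCat.epi_iff_surjective]
    refine tensMap_surjective S.g (𝟙 P) (fun i j => ?_) n
    rw [tensMapAt_id]
    exact LinearMap.rTensor_surjective (P.X j) (surj i)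

/-- In a short exact sequence with acyclic middle term, exactness of the outer terms agrees up to a
shift of degrees. -/
lemma exactAt_iff_of_acyclic_X₂ {S : ShortComplex (Cplx A)} (hS : S.ShortExact)
    (h : S.X₂.Acyclic) (n : ℤ) : S.X₁.ExactAt n ↔ S.X₃.ExactAt (n - 1) := by
  have hn : (ComplexShape.up ℤ).Rel (n - 1) n := by simp
  rw [exactAt_iff_isZero_homology, exactAt_iff_isZero_homology]
  exact (hS.δIso (n - 1) n hn (h _).isZero_homology (h _).isZero_homology).isZero_iff.symm

lemma exactAt_iff_of_acyclic_X₃ {S : ShortComplex (Cplx A)} (hS : S.ShortExact)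
    (h : S.X₃.Acyclic) (n : ℤ) : S.X₁.ExactAt n ↔ S.X₂.ExactAt n := by
  refine ⟨fun h₁ => hS.exactAt_X₂ n h₁ (h n), fun h₂ => ?_⟩
  rw [exactAt_iff_isZero_homology]
  exact (hS.homology_exact₁ (n - 1) n (by simp)).isZero_of_both_zeros
    ((h _).isZero_homology.eq_of_src _ _) (h₂.isZero_homology.eq_of_tgt _ _)

lemma acyclic_mappingCone_iff {K L : Cplx A} (φ : K ⟶ L) :
    (CochainComplex.mappingCone φ).Acyclic ↔ QuasiIso φ := by
  rw [← HomotopyCategory.quotient_obj_mem_subcategoryAcyclic_iff_acyclic,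
    ← HomologicalComplex.mem_quasiIso_iff, ← HomotopyCategory.quotient_map_mem_quasiIso_iff,
    HomotopyCategory.quasiIso_eq_trW_subcategoryAcyclic]
  exact (ObjectProperty.trW_iff_of_distinguished _ _
    (HomotopyCategory.mappingCone_triangleh_distinguished φ)).symm

/-- Tensoring with a bounded above complex of flat modules respects quasi-isomorphisms. -/
lemma tens_exactAt_iff_of_quasiIso (φ : X ⟶ Z) [QuasiIso φ] (hP : ∀ j > 0, IsZero (P.X j))
    (hflat : ∀ j, Module.Flat A (P.X j)) (n : ℤ) :
    (tens X P).ExactAt n ↔ (tens Z P).ExactAt n := by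
  -- Both sides are compared with `X⟦1⟧ ⊗ P`, through the cones of `φ` and of the identity.
  have key {Y : Cplx A} (ψ : X ⟶ Y) [QuasiIso ψ] :
      (tens Y P).ExactAt n ↔ (tens (X⟦(1 : ℤ)⟧) P).ExactAt (n - 1) :=
    exactAt_iff_of_acyclic_X₂ (tensShortComplex_shortExact (coneSequence_shortExact ψ) hflat)
      (tens_acyclic ((acyclic_mappingCone_iff ψ).2 inferInstance) hP hflat) n
  exact (key (𝟙 X)).trans (key φ).symm

end TensorMap

/-! ### Localization of complexes -/

section Localization

variable {A : Type u} [CommRing A]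

/-- Localization of modules at the powers of `f`, as a functor to modules over the localized
ring. -/
abbrev awayFunctor (f : A) :
    ModuleCat.{u} A ⥤ ModuleCat.{u} (Localization (Submonoid.powers f)) :=
  ModuleCat.localizedModuleFunctor (Submonoid.powers f)

/-- Restriction of scalars from the localization of `A` at the powers of `f`. -/
abbrev awayRestrict (f : A) :
    ModuleCat.{u} (Localization (Submonoid.powers f)) ⥤ ModuleCat.{u} A :=
  ModuleCat.restrictScalars (algebraMap A (Localization (Submonoid.powers f)))

/-- Localization of modules at the powers of `f`. -/
abbrev locFunctor (f : A) : ModuleCat.{u} A ⥤ ModuleCat.{u} A := awayFunctor f ⋙ awayRestrict f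

lemma localizedModuleMkLinearMap_smul (f : A) (N : ModuleCat.{u} A) (a : A) (x : N) :
    N.localizedModuleMkLinearMap (Submonoid.powers f) (a • x) =
      algebraMap A (Localization (Submonoid.powers f)) a •
        N.localizedModuleMkLinearMap (Submonoid.powers f) x := by
  rw [map_smul, algebraMap_smul]

/-- The localization map of a module. -/
def toLoc (f : A) (N : ModuleCat.{u} A) : N ⟶ (locFunctor f).obj N :=
  ModuleCat.ofHom (Y := (locFunctor f).obj N)
    { toFun := fun x => N.localizedModuleMkLinearMap (Submonoid.powers f) x
      map_add' := fun x y => map_add (N.localizedModuleMkLinearMap (Submonoid.powers f)) x y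
      map_smul' := fun a x => localizedModuleMkLinearMap_smul f N a x }

lemma isUnit_of_module_localization (f : A) (N : ModuleCat.{u} (Localization (Submonoid.powers f)))
    (s : Submonoid.powers f) :
    IsUnit (algebraMap A (Module.End A ((awayRestrict f).obj N)) s) := by
  obtain ⟨u, hu⟩ := (IsLocalization.map_units (Localization (Submonoid.powers f)) s)
  rw [Module.End.isUnit_iff]
  have h1 (x : N) : (u⁻¹.1 • u.1 • x : N) = x := by rw [smul_smul, u.inv_mul, one_smul]
  have h2 (x : N) : (u.1 • u⁻¹.1 • x : N) = x := by rw [smul_smul, u.mul_inv, one_smul]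
  have h3 (x : N) : (algebraMap A (Module.End A ((awayRestrict f).obj N)) s) x = (u.1 • x : N) := by
    rw [hu]; rfl
  refine ⟨fun x y hxy => ?_, fun x => ⟨(u⁻¹.1 • x : N), (h3 _).trans (h2 x)⟩⟩
  have hxy' : (u.1 • x : N) = u.1 • y := (h3 x).symm.trans (hxy.trans (h3 y))
  exact (h1 x).symm.trans ((congrArg (fun z : N => u⁻¹.1 • z) hxy').trans (h1 y))

instance (f : A) (N : ModuleCat.{u} A) :
    IsLocalizedModule (Submonoid.powers f) (toLoc f N).hom where
  map_units s := isUnit_of_module_localization f _ s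
  surj := fun (y : N.localizedModule (Submonoid.powers f)) => by
    obtain ⟨x, hx⟩ := IsLocalizedModule.surj (Submonoid.powers f)
      (N.localizedModuleMkLinearMap (Submonoid.powers f)) y
    have hx' : algebraMap A (Localization (Submonoid.powers f)) x.2.1 • y =
          N.localizedModuleMkLinearMap (Submonoid.powers f) x.1 := by
      rw [algebraMap_smul, ← hx]
      rfl
    exact ⟨x, hx'⟩
  exists_of_eq {x y} h := by
    have h' : N.localizedModuleMkLinearMap (Submonoid.powers f) x =
      N.localizedModuleMkLinearMap (Submonoid.powers f) y := h
    exact IsLocalizedModule.exists_of_eq h'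

lemma toLoc_naturality (f : A) {N N' : ModuleCat.{u} A} (φ : N ⟶ N') :
    φ ≫ toLoc f N' = toLoc f N ≫ (locFunctor f).map φ := by
  have h (x : N) : N'.localizedModuleMkLinearMap (Submonoid.powers f) (φ.hom x) =
      ((awayFunctor f).map φ).hom (N.localizedModuleMkLinearMap (Submonoid.powers f) x) :=
    (IsLocalizedModule.map_apply (Submonoid.powers f)
      (N.localizedModuleMkLinearMap (Submonoid.powers f))
      (N'.localizedModuleMkLinearMap (Submonoid.powers f)) φ.hom x).symm
  ext x
  exact h x

/-- The localization maps, as a natural transformation. -/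
def toLocNat (f : A) : 𝟭 (ModuleCat.{u} A) ⟶ locFunctor f where
  app N := toLoc f N
  naturality _ _ φ := toLoc_naturality f φ

/-- A localization map is bijective when its source is already local. -/
lemma bijective_of_isLocalizedModule {S : Submonoid A} {H H' : Type*} [AddCommGroup H]
    [AddCommGroup H'] [Module A H] [Module A H'] (g : H →ₗ[A] H') [IsLocalizedModule S g]
    (hS : ∀ s : S, IsUnit (algebraMap A (Module.End A H) s)) : Function.Bijective g := by
  constructor
  · intro x y hxy
    obtain ⟨s, hs⟩ := IsLocalizedModule.exists_of_eq (S := S) hxy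
    exact ((Module.End.isUnit_iff _).1 (hS s)).1 hs
  · intro y
    obtain ⟨⟨x, s⟩, hx⟩ := IsLocalizedModule.surj S g y
    obtain ⟨x', rfl⟩ := ((Module.End.isUnit_iff _).1 (hS s)).2 x
    refine ⟨x', ((Module.End.isUnit_iff _).1 (IsLocalizedModule.map_units g s)).1 ?_⟩
    exact (map_smul g s.1 x').symm.trans hx.symm

lemma isUnit_algebraMap_powers {f : A} {H : Type*} [AddCommGroup H] [Module A H]
    (hf : IsUnit (algebraMap A (Module.End A H) f)) (s : Submonoid.powers f) :
    IsUnit (algebraMap A (Module.End A H) s) := by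
  obtain ⟨_, n, rfl⟩ := s
  rw [map_pow]
  exact hf.pow n

instance (f : A) : (awayFunctor f).PreservesHomology :=
  Functor.preservesHomologyOfExact _

instance (f : A) : (locFunctor f).PreservesHomology := by
  have := ((Functor.exact_tfae (locFunctor f)).out 1 2).1 fun S hS => by
    have := ModuleCat.localizedModuleFunctor_map_exact (Submonoid.powers f) S hS
    rw [ShortComplex.ShortExact.moduleCat_exact_iff_function_exact] at this ⊢
    exact this
  exact this

/-- The localization of a complex. -/
abbrev locCplx (f : A) (X : Cplx A) : Cplx A :=
  ((locFunctor f).mapHomologicalComplex (ComplexShape.up ℤ)).obj X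

/-- The localization map of a complex. -/
abbrev toLocCplx (f : A) (X : Cplx A) : X ⟶ locCplx f X where
  f i := toLoc f (X.X i)
  comm' i j _ := (toLoc_naturality f (X.d i j)).symm

lemma toLocCplx_quasiIso {f : A} {X : Cplx A} (hX : HInvertibleFor f X) :
    QuasiIso (toLocCplx f X) := by
  rw [quasiIso_iff]
  intro n
  rw [quasiIsoAt_iff_isIso_homologyMap]
  have h1 : IsIso (toLoc f (X.homology n)) := by
    rw [ConcreteCategory.isIso_iff_bijective]
    exact bijective_of_isLocalizedModule (S := Submonoid.powers f) (toLoc f (X.homology n)).hom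
      (isUnit_algebraMap_powers (hX n))
  have h2 := NatTrans.app_homology (toLocNat f) (X.sc n)
  have h3 : IsIso ((toLocNat f).app (X.sc n).homology) := h1
  rw [h2, isIso_comp_left_iff, isIso_comp_right_iff] at h3
  exact h3

end Localization

/-! ### Vanishing of derived tensor products of local and torsion objects -/

section Vanishing

variable {A : Type u} [CommRing A]

open HomologicalComplex MonoidalCategory

lemma tensMap_id (X P : Cplx A) : tensMap (𝟙 X) (𝟙 P) = 𝟙 _ := by
  refine hom_ext _ _ fun n => mapBifunctor.hom_ext fun i j (h : i + j = n) => ?_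
  change tensι X P h ≫ _ = tensι X P h ≫ _
  rw [tensι_tensMap, tensMapAt_id, id_f, id_f, id_whiskerRight, Category.id_comp, Category.comp_id]

lemma tensMap_zero_right {X Z P Q : Cplx A} (φ : X ⟶ Z) : tensMap φ (0 : P ⟶ Q) = 0 := by
  refine hom_ext _ _ fun n => mapBifunctor.hom_ext fun i j (h : i + j = n) => ?_
  change tensι X P h ≫ _ = tensι X P h ≫ _
  rw [tensι_tensMap, tensMapAt, zero_f, zero_f, comp_zero, MonoidalPreadditive.whiskerLeft_zero,
    comp_zero, zero_comp]

lemma isZero_awayFunctor_obj {f : A} {N : ModuleCat.{u} A}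
    (hN : ∀ x : N, ∃ k : ℕ, f ^ k • x = 0) : IsZero ((awayFunctor f).obj N) := by
  refine @ModuleCat.isZero_of_subsingleton _ _ _ ?_
  have h0 (y : N.localizedModule (Submonoid.powers f)) : y = 0 := by
    obtain ⟨⟨x, s⟩, hx⟩ := IsLocalizedModule.surj (Submonoid.powers f)
      (N.localizedModuleMkLinearMap (Submonoid.powers f)) y
    obtain ⟨k, hk⟩ := hN x
    let t : Submonoid.powers f := ⟨f ^ k, k, rfl⟩
    refine IsLocalizedModule.smul_injective (N.localizedModuleMkLinearMap (Submonoid.powers f))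
      (t * s) ?_
    have : t • s • y = 0 := by
      rw [hx]
      refine ((N.localizedModuleMkLinearMap (Submonoid.powers f)).map_smul (f ^ k) x).symm.trans ?_
      rw [hk, map_zero]
    change (t * s) • y = (t * s) • (0 : N.localizedModule (Submonoid.powers f))
    rw [mul_smul, this, smul_zero]
  exact ⟨fun y y' => (h0 y).trans (h0 y').symm⟩

variable (N : ModuleCat.{u} A)

lemma module_projective_resolution (j : ℤ) :
    Module.Projective A ((projectiveResolution N).cochainComplex.X j) := by
  have : Projective ((projectiveResolution N).cochainComplex.X j) := inferInstance
  rwa [← IsProjective.iff_projective] at this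

lemma flat_resolution (j : ℤ) : Module.Flat A ((projectiveResolution N).cochainComplex.X j) :=
  have := module_projective_resolution N j
  inferInstance

lemma isZero_resolution (j : ℤ) (hj : j > 0) :
    IsZero ((projectiveResolution N).cochainComplex.X j) :=
  CochainComplex.isZero_of_isStrictlyLE _ 0 j hj

/-- The localization of the projective resolution of `N`, over the localized ring. -/
abbrev awayResolution (f : A) :
    CochainComplex (ModuleCat.{u} (Localization (Submonoid.powers f))) ℤ :=
  ((awayFunctor f).mapHomologicalComplex (ComplexShape.up ℤ)).obj
    (projectiveResolution N).cochainComplex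

instance (f : A) : (awayResolution N f).IsKProjective := by
  have (j : ℤ) : Projective ((awayResolution N f).X j) := by
    have := module_projective_resolution N j
    have := Module.projective_of_isLocalizedModule (Rₛ := Localization (Submonoid.powers f))
      (Submonoid.powers f) (((projectiveResolution N).cochainComplex.X j).localizedModuleMkLinearMap
        (Submonoid.powers f))
    rw [IsProjective.iff_projective] at this
    exact this
  have : (awayResolution N f).IsStrictlyLE 0 := by
    rw [CochainComplex.isStrictlyLE_iff]
    exact fun j hj => (awayFunctor f).map_isZero (isZero_resolution N j hj)
  exact CochainComplex.isKProjective_of_projective _ 0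

variable {N}

lemma awayResolution_acyclic {f : A} (hN : ∀ x : N, ∃ k : ℕ, f ^ k • x = 0) :
    (awayResolution N f).Acyclic := by
  let π := ((awayFunctor f).mapHomologicalComplex (ComplexShape.up ℤ)).map
    (projectiveResolution N).π'
  intro n
  rw [exactAt_iff_of_quasiIsoAt π]
  refine ExactAt.of_isZero ?_
  change IsZero ((awayFunctor f).obj (((single _ _ 0).obj N).X n))
  by_cases hn : n = 0
  · subst hn
    exact (isZero_awayFunctor_obj hN).of_iso ((awayFunctor f).mapIso (singleObjXSelf _ 0 N))
  · exact (awayFunctor f).map_isZero (isZero_single_obj_X _ 0 N n hn)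

/-- Over the localized ring, the localized resolution is an acyclic bounded above complex of
projective modules. -/
def locResolutionHomotopy {f : A} (hN : ∀ x : N, ∃ k : ℕ, f ^ k • x = 0) :
    Homotopy (𝟙 (locCplx f (projectiveResolution N).cochainComplex)) 0 :=
  (Homotopy.ofEq (((awayRestrict f).mapHomologicalComplex (ComplexShape.up ℤ)).map_id
    (awayResolution N f)).symm).trans (((awayRestrict f).mapHomotopy
    (CochainComplex.IsKProjective.homotopyZero (𝟙 (awayResolution N f))
      (awayResolution_acyclic hN))).trans (Homotopy.ofEq (Functor.map_zero _ _ _)))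

/-- If `f` acts bijectively on the cohomology of `X` and `N` is `f`-power torsion, then `X ⊗ᴸ N`
vanishes: localizing `X` does not change it, and then the resolution of `N` can be localized, too,
which makes it contractible. -/
lemma derivedTensor_acyclic {f : A} {X : Cplx A} (hX : HInvertibleFor f X)
    (hN : ∀ x : N, ∃ k : ℕ, f ^ k • x = 0) : (derivedTensor X N).Acyclic := by
  let P := (projectiveResolution N).cochainComplex
  have := toLocCplx_quasiIso hX
  intro n
  refine (tens_exactAt_iff_of_quasiIso (toLocCplx f X) (isZero_resolution N)
    (flat_resolution N) n).2 ?_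
  have hbij (i j : ℤ) :
      Function.Bijective (tensMapAt (𝟙 (locCplx f X)) (toLocCplx f P) i j).hom := by
    have h1 : tensMapAt (𝟙 (locCplx f X)) (toLocCplx f P) i j =
      (locCplx f X).X i ◁ toLoc f (P.X j) := by
        rw [tensMapAt, id_f, id_whiskerRight, Category.id_comp]
        rfl
    rw [h1]
    have hu (s : Submonoid.powers f) : IsUnit (algebraMap A (Module.End A ((locCplx f X).X i)) s) :=
      isUnit_of_module_localization f _ s
    have : IsLocalizedModule (Submonoid.powers f)
        (LinearMap.id (R := A) (M := (locCplx f X).X i)) :=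
      { map_units := hu
        surj := fun y => ⟨⟨y, 1⟩, one_smul _ y⟩
        exists_of_eq := fun h => ⟨1, congrArg _ h⟩ }
    have h2 : IsLocalizedModule (Submonoid.powers f)
      (TensorProduct.map (LinearMap.id (R := A) (M := (locCplx f X).X i)) (toLoc f (P.X j)).hom) :=
        inferInstance
    refine bijective_of_isLocalizedModule (S := Submonoid.powers f)
      (TensorProduct.map (LinearMap.id (R := A) (M := (locCplx f X).X i)) (toLoc f (P.X j)).hom)
      fun s => ?_
    have := (hu s).map (Module.End.rTensorAlgHom A ((locCplx f X).X i) (P.X j))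
    rwa [AlgHom.commutes] at this
  have := tensMap_isIso _ _ hbij
  rw [exactAt_iff_of_quasiIsoAt (tensMap (𝟙 (locCplx f X)) (toLocCplx f P)),
    exactAt_iff_isZero_homology]
  have h : Homotopy (tensMap (𝟙 (locCplx f X)) (𝟙 (locCplx f P))) (tensMap (𝟙 (locCplx f X)) 0) :=
    mapBifunctorMapHomotopy₂ _ (locResolutionHomotopy hN) _ _
  rw [IsZero.iff_id_eq_zero, ← homologyMap_id, ← tensMap_id, h.homologyMap_eq, tensMap_zero_right,
    homologyMap_zero]

end Vanishing

/-! ### Orthogonality of local and complete complexes -/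

section Orthogonality

variable {A : Type u} [CommRing A]

open HomologicalComplex

lemma HCompleteFor.of_quasiIso {f : A} {K L : Cplx A} (h : HCompleteFor f K) (φ : K ⟶ L)
    [QuasiIso φ] : HCompleteFor f L := by
  intro n
  exact IsCompleteEnd.of_equiv (φ₁ := algebraMap A (Module.End A (K.homology n)) f)
    (asIso (homologyMap φ n)).toLinearEquiv
    (fun x => ((homologyMap φ n).hom.map_smul f x).symm) (h n)

/-- Division by `f` on a localized complex. -/
def locDiv (f : A) (X : Cplx A) : locCplx f X ⟶ locCplx f X :=
  ((awayRestrict f).mapHomologicalComplex (ComplexShape.up ℤ)).map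
    (IsLocalization.mk' (Localization (Submonoid.powers f)) 1
        (⟨f, Submonoid.mem_powers f⟩ : Submonoid.powers f) •
      𝟙 (((awayFunctor f).mapHomologicalComplex (ComplexShape.up ℤ)).obj X))

lemma smul_locDiv (f : A) (X : Cplx A) : f • locDiv f X = 𝟙 _ := by
  ext i (x : (X.X i).localizedModule (Submonoid.powers f))
  have h : algebraMap A (Localization (Submonoid.powers f)) f *
      IsLocalization.mk' (Localization (Submonoid.powers f)) 1
        (⟨f, Submonoid.mem_powers f⟩ : Submonoid.powers f) = 1 :=
    (IsLocalization.mk'_spec' _ 1 (⟨f, Submonoid.mem_powers f⟩ : Submonoid.powers f)).trans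
      (map_one _)
  have h' : algebraMap A (Localization (Submonoid.powers f)) f •
      (IsLocalization.mk' (Localization (Submonoid.powers f)) 1
        (⟨f, Submonoid.mem_powers f⟩ : Submonoid.powers f)) • x = x := by
    rw [smul_smul, h, one_smul]
  exact h'

/-- Division by `f ^ n` on a localized complex. -/
def locDivPow (f : A) (X : Cplx A) : ℕ → (locCplx f X ⟶ locCplx f X)
  | 0 => 𝟙 _
  | n + 1 => locDiv f X ≫ locDivPow f X n

/-- The terms of sequences in a complex. -/
abbrev seqProj (E : Cplx A) (n : ℕ) : Seq E ⟶ E := (seqFan E).proj n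

/-- The maps `φ, φ / f, φ / f², …`, assembled to a map to sequences. -/
def divSeq {f : A} {X E : Cplx A} (φ : locCplx f X ⟶ E) : locCplx f X ⟶ Seq E :=
  (seqFanIsLimit E).lift (Fan.mk _ fun n => locDivPow f X n ≫ φ)

lemma divSeq_proj {f : A} {X E : Cplx A} (φ : locCplx f X ⟶ E) (n : ℕ) :
    divSeq φ ≫ seqProj E n = locDivPow f X n ≫ φ :=
  (seqFanIsLimit E).fac _ ⟨n⟩

lemma divSeq_tower {f : A} {X E : Cplx A} (φ : locCplx f X ⟶ E) :
    divSeq φ ≫ Seq.nat (natTower f) E = 0 := by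
  refine Fan.IsLimit.hom_ext (seqFanIsLimit E) _ _ fun n => ?_
  change (divSeq φ ≫ Seq.nat (natTower f) E) ≫ seqProj E n = 0 ≫ seqProj E n
  have h : Seq.nat (natTower f) E ≫ seqProj E n = seqProj E n - f • seqProj E (n + 1) := by
    ext i x
    rfl
  rw [Category.assoc, h, Preadditive.comp_sub, Linear.comp_smul, divSeq_proj, divSeq_proj,
    zero_comp, locDivPow, Category.assoc, ← Linear.smul_comp, smul_locDiv, Category.id_comp,
    sub_self]

variable [HasDerivedCategory.{w} (ModuleCat.{u} A)]

open DerivedCategory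

/-- There are no nonzero maps in the derived category from a complex on whose cohomology `f` acts
bijectively to a complex on whose cohomology `f` acts completely. -/
lemma hom_eq_zero {f : A} {X E : Cplx A} (hX : HInvertibleFor f X) (hE : HCompleteFor f E)
    (g : Q.obj X ⟶ Q.obj E) : g = 0 := by
  have := toLocCplx_quasiIso hX
  have : IsIso (Q.map (toLocCplx f X)) := by rwa [isIso_Q_map_iff_quasiIso]
  obtain ⟨E', φ, s, hs, h⟩ := left_fac (inv (Q.map (toLocCplx f X)) ≫ g)
  have hs' : QuasiIso s := by rwa [isIso_Q_map_iff_quasiIso] at hs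
  have hE' := (hE.of_quasiIso s)
  have : IsIso (Q.map (Seq.nat (natTower f) E')) := by
    rw [isIso_Q_map_iff_quasiIso]
    exact (quasiIso_seqTower_iff f E').2 hE'
  -- The sequence `φ, φ / f, …` dies in the derived category, hence so does its first term.
  have h0 : Q.map (divSeq φ) = 0 := by
    rw [← cancel_mono (Q.map (Seq.nat (natTower f) E')), ← Q.map_comp, divSeq_tower, Q.map_zero,
      zero_comp]
  have h1 : Q.map φ = 0 := by
    have := divSeq_proj φ 0
    rw [locDivPow, Category.id_comp] at this
    rw [← this, Q.map_comp, h0, zero_comp]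
  rw [h1, zero_comp] at h
  rwa [← cancel_epi (inv (Q.map (toLocCplx f X))), comp_zero]

end Orthogonality

/-! ### Derived completions -/

section DerivedCompletion

variable {A : Type u} [CommRing A]

open HomologicalComplex

lemma acyclic_shift_iff (K : Cplx A) (a : ℤ) : (K⟦a⟧).Acyclic ↔ K.Acyclic := by
  have key (m n : ℤ) (h : a + m = n) : (K⟦a⟧).ExactAt m ↔ K.ExactAt n := by
    rw [exactAt_iff_isZero_homology, exactAt_iff_isZero_homology]
    exact ((CochainComplex.ShiftSequence.shiftIso (ModuleCat.{u} A) a m n h).app K).isZero_iff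
  exact ⟨fun h n => (key (n - a) n (by omega)).1 (h _), fun h n => (key n (a + n) rfl).2 (h _)⟩

lemma derivedTower_acyclic_iff (f : A) (K : Cplx A) :
    (derivedTower f K).Acyclic ↔ HCompleteFor f K := by
  rw [derivedTower, acyclic_shift_iff, acyclic_mappingCone_iff, quasiIso_towerMap_iff]
  rfl

/-- Derived completeness with respect to an ideal can be tested on generators. -/
lemma isDerivedComplete_span_pair_iff (p d : A) (K : Cplx A) :
    IsDerivedComplete (Ideal.span {p, d}) K ↔ HCompleteFor p K ∧ HCompleteFor d K := by
  simp only [IsDerivedComplete, derivedTower_acyclic_iff]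
  refine ⟨fun h => ⟨h p (Ideal.subset_span (by simp)), h d (Ideal.subset_span (by simp))⟩, ?_⟩
  rintro ⟨hp, hd⟩ f hf n
  obtain ⟨a, b, rfl⟩ := Ideal.mem_span_pair.1 hf
  have comm (x y : A) : Commute (algebraMap A (Module.End A (K.homology n)) x)
      (algebraMap A (Module.End A (K.homology n)) y) := Algebra.commutes x _
  have h : IsCompleteEnd (algebraMap A (Module.End A (K.homology n)) (p * a + d * b)) := by
    rw [map_add, map_mul, map_mul, ← map_mul, ← map_mul]
    refine IsCompleteEnd.add ?_ ?_ (comm _ _)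
    · rw [map_mul]
      exact (hp n).mul (comm _ _)
    · rw [map_mul]
      exact (hd n).mul (comm _ _)
  rwa [mul_comm p, mul_comm d] at h

lemma HCompleteFor.shift {f : A} {K : Cplx A} (h : HCompleteFor f K) :
    HCompleteFor f (K⟦(1 : ℤ)⟧) := by
  rw [hCompleteFor_iff] at h ⊢
  have := h.shift
  rwa [show (f • 𝟙 K)⟦(1 : ℤ)⟧' = f • 𝟙 (K⟦(1 : ℤ)⟧) from rfl] at this

/-- The derived tensor product with a torsion module does not see the completion. -/
lemma IsCompletelyFlat.completionAt {I : Ideal A} {M : Cplx A} (hM : IsCompletelyFlat I M) {f : A}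
    (hf : f ∈ I) : IsCompletelyFlat I (completionAt f M) := by
  intro N hN n hn
  refine (exactAt_iff_of_acyclic_X₃ (tensShortComplex_shortExact
    (completionSequence_shortExact f M) (flat_resolution N)) ?_ n).1 (hM N hN n hn)
  refine derivedTensor_acyclic (hInvertibleFor_towerCone f M) fun x => ?_
  obtain ⟨k, hk⟩ := hN x
  exact ⟨k, hk _ (Ideal.pow_mem_pow hf k)⟩

lemma IsCompletelyFlat.iff_of_quasiIso {I : Ideal A} {K L : Cplx A} (φ : K ⟶ L) [QuasiIso φ] :
    IsCompletelyFlat I K ↔ IsCompletelyFlat I L :=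
  forall₄_congr fun N _ n _ =>
    tens_exactAt_iff_of_quasiIso φ (isZero_resolution N) (flat_resolution N) n

open Pretriangulated in
/-- If no nonzero maps lead from the cofibre of `T.obj₁ ⟶ T.obj₂` to `E` and `E⟦1⟧`, every map
`T.obj₁ ⟶ E` extends uniquely to `T.obj₂`. -/
lemma bijective_comp_of_distinguished {C : Type*} [Category* C] [Preadditive C] [HasZeroObject C]
    [HasShift C ℤ] [∀ n : ℤ, (shiftFunctor C n).Additive] [Pretriangulated C] {T : Triangle C}
    (hT : T ∈ distTriang C) {E : C} (h : ∀ k : T.obj₃ ⟶ E, k = 0)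
    (h' : ∀ k : T.obj₃ ⟶ E⟦(1 : ℤ)⟧, k = 0) :
    Function.Bijective fun g : T.obj₂ ⟶ E => T.mor₁ ≫ g := by
  constructor
  · intro g g' hg
    obtain ⟨k, hk⟩ := Triangle.yoneda_exact₂ _ hT (g - g')
      (by rw [Preadditive.comp_sub, sub_eq_zero]; exact hg)
    rw [h k, comp_zero] at hk
    exact sub_eq_zero.1 hk
  · intro k
    obtain ⟨g, hg⟩ := Triangle.yoneda_exact₃ _ (rot_of_distTriang _ hT) (k⟦(1 : ℤ)⟧') (h' _)
    obtain ⟨g' : T.obj₂ ⟶ E, rfl⟩ := (shiftFunctor C (1 : ℤ)).map_surjective g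
    refine ⟨-g', (shiftFunctor C (1 : ℤ)).map_injective ?_⟩
    change (shiftFunctor C (1 : ℤ)).map (T.mor₁ ≫ (-g')) = _
    rw [Functor.map_comp, Functor.map_neg, Preadditive.comp_neg, ← Preadditive.neg_comp]
    exact hg.symm

variable [HasDerivedCategory.{w} (ModuleCat.{u} A)]

open DerivedCategory Pretriangulated

lemma IsCompletelyFlat.of_iso {I : Ideal A} {K L : Cplx A} (hK : IsCompletelyFlat I K)
    (e : Q.obj K ≅ Q.obj L) : IsCompletelyFlat I L := by
  obtain ⟨Z, φ, s, hs, h⟩ := left_fac e.hom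
  have : IsIso (Q.map φ) := by
    have h' : Q.map φ = e.hom ≫ Q.map s := by rw [h, Category.assoc, IsIso.inv_hom_id,
      Category.comp_id]
    rw [h']
    infer_instance
  rw [isIso_Q_map_iff_quasiIso] at this hs
  exact (IsCompletelyFlat.iff_of_quasiIso s).2 ((IsCompletelyFlat.iff_of_quasiIso φ).1 hK)

/-- The completion with respect to one element is universal, because the cofibre of
`M ⟶ completionAt f M` is local. -/
lemma bijective_toCompletionAt_comp (f : A) (M : Cplx A) {E : Cplx A} (hE : HCompleteFor f E) :
    Function.Bijective fun g : Q.obj (completionAt f M) ⟶ Q.obj E =>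
      Q.map (toCompletionAt f M) ≫ g := by
  have hX := hInvertibleFor_towerCone f M
  refine bijective_comp_of_distinguished
    (triangleOfSES_distinguished (completionSequence_shortExact f M)) (hom_eq_zero hX hE)
    fun k => ?_
  rw [← cancel_mono ((Q.commShiftIso (1 : ℤ)).inv.app E), zero_comp]
  exact hom_eq_zero hX hE.shift _

/-- The derived completion with respect to two elements is the iterated completion. -/
lemma isDerivedCompletion_iterated (p d : A) (M : Cplx A) :
    IsDerivedCompletion (Ideal.span {p, d})
      (Q.map (toCompletionAt p M) ≫ Q.map (toCompletionAt d (completionAt p M))) where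
  complete := (isDerivedComplete_span_pair_iff p d _).2
    ⟨(hCompleteFor_completionAt p M).completionAt d, hCompleteFor_completionAt d _⟩
  universal E hE := by
    obtain ⟨hp, hd⟩ := (isDerivedComplete_span_pair_iff p d E).1 hE
    convert (bijective_toCompletionAt_comp p M hp).comp
      (bijective_toCompletionAt_comp d (completionAt p M) hd) using 2
    exact Category.assoc _ _ _

lemma IsDerivedCompletion.nonempty_iso {I : Ideal A} {M K L : Cplx A} {η : Q.obj M ⟶ Q.obj K}
    {θ : Q.obj M ⟶ Q.obj L} (hη : IsDerivedCompletion I η) (hθ : IsDerivedCompletion I θ) :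
    Nonempty (Q.obj K ≅ Q.obj L) := by
  obtain ⟨a, ha⟩ := (hη.universal L hθ.complete).2 θ
  obtain ⟨b, hb⟩ := (hθ.universal K hη.complete).2 η
  dsimp only at ha hb
  refine ⟨⟨a, b, (hη.universal K hη.complete).1 ?_, (hθ.universal L hθ.complete).1 ?_⟩⟩
  · change η ≫ a ≫ b = η ≫ 𝟙 _
    rw [← Category.assoc, ha, hb, Category.comp_id]
  · change θ ≫ b ≫ a = θ ≫ 𝟙 _
    rw [← Category.assoc, hb, ha, Category.comp_id]

end DerivedCompletion

end CompletelyFlat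

end

theorem mainTheorem12 {A : Type u} [CommRing A] [HasDerivedCategory.{w} (ModuleCat.{u} A)]
    (p d : A) (hd : d ∈ nonZeroDivisors A)
    (M : CompletelyFlat.Cplx A)
    (hM : CompletelyFlat.IsCompletelyFlat (Ideal.span {p, d}) M) :
    (∃ (M' : CompletelyFlat.Cplx A)
        (η : DerivedCategory.Q.obj M ⟶ DerivedCategory.Q.obj M'),
        CompletelyFlat.IsDerivedCompletion (Ideal.span {p, d}) η) ∧
      ∀ (M' : CompletelyFlat.Cplx A)
        (η : DerivedCategory.Q.obj M ⟶ DerivedCategory.Q.obj M'),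
        CompletelyFlat.IsDerivedCompletion (Ideal.span {p, d}) η →
          CompletelyFlat.IsCompletelyFlat (Ideal.span {p, d}) M' := by
  have hη := CompletelyFlat.isDerivedCompletion_iterated p d M
  refine ⟨⟨_, _, hη⟩, fun M' η h => ?_⟩
  obtain ⟨e⟩ := hη.nonempty_iso h
  exact ((hM.completionAt (Ideal.subset_span (by simp))).completionAt
    (Ideal.subset_span (by simp))).of_iso e
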